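/- Let $A=(a_1,\dots,a_n)$ be an $(n-2)\times n$ integer matrix of rank $n-2$ whose rational row space contains $(1,\dots,1)$ (so the projective toric variety $X_A\subset\mathbb P^{n-1}$ has codimension two), and let $P=\mathrm{Conv}(A)$ be the convex hull of its columns in $\mathbb R^{n-2}$. Let $B$ be a Gale dual of $A$, that is, an $n\times 2$ integer matrix whose columns generate $\ker_{\mathbb Z}A\subset\mathbb Z^n$, and assume that all rows $b_1,\dots,b_n$ of $B$ are nonzero (that is, $X_A$ is not a cone over a coordinate point). A line through $0$ in $\mathbb R^2$ is called relevant if it contains two rows $b_r,b_s$ of $B$ pointing in opposite directions. For nonempty faces $\beta\subset\alpha$ of $P$, let $\mathbb Z\alpha$ be the lattice generated by the $a_i\in\alpha$ and $\mathbb R\beta$ the linear span of $\beta$, and define $$i(\alpha,\beta)=[\mathbb Z\alpha\cap\mathbb R\beta:\mathbb Z\beta],\qquad \mu(\alpha,\beta)=\mathrm{Vol}(\mathrm{Conv}(A_\alpha/\beta))-\mathrm{Vol}(\mathrm{Conv}((A_\alpha/\beta)\setminus\{0\})),$$ where $A_\alpha/\beta$ is the image of $\{a_i : a_i\in\alpha\}$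 in the lattice $L=\mathbb Z\alpha/(\mathbb Z\alpha\cap\mathbb R\beta)$ of rank $m$, and $\mathrm{Vol}$ is $m!$ times the $m$-dimensional volume for which $L$ has covolume one. Let $\beta$ be a nonempty proper face of $P$, let $\mathfrak I_\beta=\{i : a_i\notin\beta\}$ and $r=|\mathfrak I_\beta|$, and let $B_\beta$ be the $r\times 2$ matrix with rows $b_i$, $i\in\mathfrak I_\beta$. Assume that the rows of $B_\beta$ are not all contained in one relevant line. Put $w_\beta=-\sum_{i\in\mathfrak I_\beta}b_i$ and let $B'_\beta$ be the $(r+1)\times2$ matrix obtained by adding the row $w_\beta$ to $B_\beta$. Let $\mathbb Z B'_\beta\subset\mathbb Z^{r+1}$ be the lattice spanned by the columns of $B'_\beta$, let $T(\mathbb Z^{r+1}/\mathbb Z B'_\beta)$ be the torsion subgroup of the quotient, let $I_{B'_\beta}=(x^{l^+}-x^{l^-} : l\in\mathbb Z B'_\beta)$, where $l^+$ and $l^-$ are the positive and negative parts of $l=l^+-l^-$, be the corresponding lattice ideal in the polynomial ring in $r+1$ variables over $\mathbb C$, and let $\deg(I_{B'_\beta})$ be its degree with respect to the standard grading. Then $$\mu(P,\beta)=\frac{\deg(I_{B'_\beta})}{|T(\mathbb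 Z^{r+1}/\mathbb Z B'_\beta)|}-\frac{\sum_{j\in\mathfrak I_\beta,\ \det(w_\beta,b_j)>0}\det(w_\beta,b_j)}{|T(\mathbb Z^{r+1}/\mathbb Z B'_\beta)|},$$ $$i(P,\beta)=|T(\mathbb Z^{r+1}/\mathbb Z B'_\beta)|=\gcd\big(\det(b_i,b_j)\big)_{i,j\in\mathfrak I_\beta}.$$ -/

import Mathlib

noncomputable section

namespace ToricGale

/-- The inclusion of `ℤ^m` into `ℝ^m`. -/
def castVec {m : ℕ} : (Fin m → ℤ) →ₗ[ℤ] (Fin m → ℝ) :=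
  (Int.castAddHom ℝ).toIntLinearMap.compLeft (Fin m)

/-- The determinant of the `2 × 2` matrix with rows `v` and `w`. -/
def det2 (v w : Fin 2 → ℤ) : ℤ := Matrix.det (Matrix.of ![v, w])

/-! ### Point configurations and their polytopes -/

section Polytope

variable {d n : ℕ}

/-- The `i`-th column `a_i` of `A`, a lattice point in `ℤ^d`. -/
def point (A : Matrix (Fin d) (Fin n) ℤ) (i : Fin n) : Fin d → ℤ := fun k => A k i

/-- The polytope `P = Conv(A)` in `ℝ^d`. -/
def polytope (A : Matrix (Fin d) (Fin n) ℤ) : Set (Fin d → ℝ) :=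
  convexHull ℝ (Set.range fun i => castVec (point A i))

/-- `A` defines a projective toric variety of dimension `d - 1` in `ℙ^(n-1)`: it has rank `d`, and
the all-ones vector lies in its rational row space. -/
structure IsToricMatrix (A : Matrix (Fin d) (Fin n) ℤ) : Prop where
  rank_eq : (A.map (Int.cast : ℤ → ℚ)).rank = d
  ones_mem : (fun _ => 1 : Fin n → ℚ) ∈
    Submodule.span ℚ (Set.range fun k : Fin d => fun i : Fin n => (A k i : ℚ))

/-- `F` is a nonempty face of `Conv(A)`: the set of maximisers of a linear functional. The polytope
itself is a face. -/
structure IsFace (A : Matrix (Fin d) (Fin n) ℤ) (F : Set (Fin d → ℝ)) : Prop where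
  nonempty : F.Nonempty
  exposed : IsExposed ℝ (polytope A) F

/-- `ℤα`: the lattice generated by the columns of `A` lying in `α`. -/
def faceLattice (A : Matrix (Fin d) (Fin n) ℤ) (α : Set (Fin d → ℝ)) :
    Submodule ℤ (Fin d → ℤ) :=
  Submodule.span ℤ {v | ∃ i, castVec (point A i) ∈ α ∧ point A i = v}

/-- The integer points of the linear span `ℝβ`. -/
def realSpan (β : Set (Fin d → ℝ)) : Submodule ℤ (Fin d → ℤ) :=
  ((Submodule.span ℝ β).restrictScalars ℤ).comap castVec

/-- The index `i(α, β) = [ℤα ∩ ℝβ : ℤβ]`. -/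
def latticeIndex (A : Matrix (Fin d) (Fin n) ℤ) (α β : Set (Fin d → ℝ)) : ℕ :=
  (faceLattice A β).toAddSubgroup.relIndex (faceLattice A α ⊓ realSpan β).toAddSubgroup

/-- The quotient lattice `ℤα / (ℤα ∩ ℝβ)`. -/
abbrev QuotientLattice (A : Matrix (Fin d) (Fin n) ℤ) (α β : Set (Fin d → ℝ)) : Type :=
  faceLattice A α ⧸ (realSpan β).submoduleOf (faceLattice A α)

instance quotientLattice_finite (A : Matrix (Fin d) (Fin n) ℤ) (α β : Set (Fin d → ℝ)) :
    Module.Finite ℤ (QuotientLattice A α β) := by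
  unfold QuotientLattice
  infer_instance

instance quotientLattice_torsionFree (A : Matrix (Fin d) (Fin n) ℤ) (α β : Set (Fin d → ℝ)) :
    Module.IsTorsionFree ℤ (QuotientLattice A α β) := by
  refine Module.isTorsionFree_iff_smul_eq_zero.2 fun r x h => ?_
  obtain ⟨v, rfl⟩ := Submodule.Quotient.mk_surjective _ x
  by_cases hr : r = 0
  · exact Or.inl hr
  · right
    rw [← Submodule.Quotient.mk_smul, Submodule.Quotient.mk_eq_zero] at h
    rw [Submodule.Quotient.mk_eq_zero]
    change castVec (r • (v : Fin d → ℤ)) ∈ Submodule.span ℝ β at h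
    change castVec (v : Fin d → ℤ) ∈ Submodule.span ℝ β
    rw [map_smul, ← Int.cast_smul_eq_zsmul ℝ] at h
    exact (Submodule.smul_mem_iff _ (Int.cast_ne_zero.2 hr)).1 h

instance quotientLattice_free (A : Matrix (Fin d) (Fin n) ℤ) (α β : Set (Fin d → ℝ)) :
    Module.Free ℤ (QuotientLattice A α β) :=
  Module.free_of_finite_type_torsion_free'

/-- `A_α/β`: the image in `ℤα / (ℤα ∩ ℝβ)` of the columns of `A` lying in `α`. -/
def quotientPoints (A : Matrix (Fin d) (Fin n) ℤ) (α β : Set (Fin d → ℝ)) :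
    Set (QuotientLattice A α β) :=
  {x | ∃ v : faceLattice A α, (∃ i, castVec (point A i) ∈ α ∧ point A i = v) ∧
    Submodule.Quotient.mk v = x}

end Polytope

/-- `Vol(Conv(S))` for a set `S` of points of a lattice `L` of rank `m`, normalised with respect to
`L`: `m!` times the Lebesgue volume of the convex hull of `S` in coordinates with respect to a
`ℤ`-basis of `L`. All bases give the same value, as they differ by matrices of determinant `±1`. -/
def normalizedVolume (L : Type) [AddCommGroup L] [Module.Free ℤ L] [Module.Finite ℤ L]
    (S : Set L) : ℝ :=
  (Module.finrank ℤ L).factorial *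
    (MeasureTheory.volume (convexHull ℝ
      ((fun x k => ((Module.finBasis ℤ L).repr x k : ℝ)) '' S :
        Set (Fin (Module.finrank ℤ L) → ℝ)))).toReal

/-- The normalised volume can be computed in any `ℤ`-basis of the lattice. -/
theorem normalizedVolume_eq (L : Type) [AddCommGroup L] [Module.Free ℤ L] [Module.Finite ℤ L]
    (S : Set L) (b : Module.Basis (Fin (Module.finrank ℤ L)) ℤ L) :
    normalizedVolume L S = (Module.finrank ℤ L).factorial *
      (MeasureTheory.volume (convexHull ℝ
        ((fun x k => (b.repr x k : ℝ)) '' S :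
          Set (Fin (Module.finrank ℤ L) → ℝ)))).toReal := by
  set c := Module.finBasis ℤ L with hc
  let M : Matrix _ _ ℤ := c.toMatrix b
  have hM : IsUnit M.det := by
    have h := congrArg Matrix.det (Module.Basis.toMatrix_mul_toMatrix_flip c b)
    rw [Matrix.det_mul, Matrix.det_one] at h
    exact IsUnit.of_mul_eq_one _ h
  let T : (Fin (Module.finrank ℤ L) → ℝ) →ₗ[ℝ] (Fin (Module.finrank ℤ L) → ℝ) :=
    Matrix.toLin' (M.map (Int.cast : ℤ → ℝ))
  have hT : ((fun x k => (c.repr x k : ℝ)) '' S : Set (Fin (Module.finrank ℤ L) → ℝ)) =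
      T '' ((fun x k => (b.repr x k : ℝ)) '' S) := by
    rw [Set.image_image]
    congr 1
    funext x
    funext k
    have h := congrFun (Module.Basis.toMatrix_mulVec_repr b c x) k
    simp only [T, Matrix.toLin'_apply]
    rw [← h]
    simp [M, Matrix.mulVec, dotProduct]
  unfold normalizedVolume
  rw [← hc, hT, ← LinearMap.image_convexHull, MeasureTheory.Measure.addHaar_image_linearMap]
  have hdet : |LinearMap.det T| = 1 := by
    have h : (M.map (Int.cast : ℤ → ℝ)).det = ((M.det : ℤ) : ℝ) :=
      (RingHom.map_det (Int.castRingHom ℝ) M).symm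
    simp only [T, LinearMap.det_toLin']
    rw [h]
    rcases Int.isUnit_iff.1 hM with h | h <;> simp [h]
  rw [hdet]
  simp

/-- The relative normalised subdiagram volume `μ(α, β)`. -/
def subdiagramVolume {d n : ℕ} (A : Matrix (Fin d) (Fin n) ℤ) (α β : Set (Fin d → ℝ)) : ℝ :=
  normalizedVolume (QuotientLattice A α β) (quotientPoints A α β) -
    normalizedVolume (QuotientLattice A α β) (quotientPoints A α β \ {0})

/-! ### Gale duality -/

/-- `ℤB`: the lattice spanned by the columns of `B`. -/
def columnLattice {σ τ : Type} (B : Matrix σ τ ℤ) : Submodule ℤ (σ → ℤ) :=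
  Submodule.span ℤ (Set.range fun k : τ => fun i : σ => B i k)

section Gale

variable {d n : ℕ}

/-- `B` is a Gale dual of `A`: the image of `B` is the integer kernel of `A`. -/
def IsGaleDual (A : Matrix (Fin d) (Fin n) ℤ) (B : Matrix (Fin n) (Fin 2) ℤ) : Prop :=
  columnLattice B = LinearMap.ker A.mulVecLin

/-- A line through `0` in `ℝ²` containing two rows `b_r`, `b_s` of `B` in opposite directions. -/
def IsRelevantLine (B : Matrix (Fin n) (Fin 2) ℤ) (ℓ : Submodule ℝ (Fin 2 → ℝ)) : Prop :=
  Module.finrank ℝ ℓ = 1 ∧ ∃ r s : Fin n, castVec (B r) ∈ ℓ ∧ castVec (B s) ∈ ℓ ∧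
    B r ≠ 0 ∧ ∃ c : ℝ, 0 < c ∧ castVec (B s) = -c • castVec (B r)

/-- `𝔍_β`: the indices of the columns of `A` that do not lie in `β`, which are the indices of the
rows of `B_β`. -/
abbrev GaleIndex (A : Matrix (Fin d) (Fin n) ℤ) (β : Set (Fin d → ℝ)) : Type :=
  {i : Fin n // castVec (point A i) ∉ β}

instance fintypeGaleIndex (A : Matrix (Fin d) (Fin n) ℤ) (β : Set (Fin d → ℝ)) : Fintype (GaleIndex A β) :=
  Fintype.ofFinite _

/-- The rows `b_i` of `B` with `a_i ∉ β`. -/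
def galeRows (A : Matrix (Fin d) (Fin n) ℤ) (B : Matrix (Fin n) (Fin 2) ℤ)
    (β : Set (Fin d → ℝ)) : Matrix (GaleIndex A β) (Fin 2) ℤ :=
  fun i => B i

/-- `w_β`, minus the sum of the rows of `B_β`. -/
def extraRow (A : Matrix (Fin d) (Fin n) ℤ) (B : Matrix (Fin n) (Fin 2) ℤ)
    (β : Set (Fin d → ℝ)) : Fin 2 → ℤ :=
  -∑ i, galeRows A B β i

/-- `B'_β`: the matrix `B_β` with the extra row `w_β`. -/
def galeRows' (A : Matrix (Fin d) (Fin n) ℤ) (B : Matrix (Fin n) (Fin 2) ℤ)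
    (β : Set (Fin d → ℝ)) : Matrix (Option (GaleIndex A β)) (Fin 2) ℤ
  | none => extraRow A B β
  | some i => galeRows A B β i

/-- The greatest common divisor of the minors `[i, j] = det(b_i, b_j)`, `i, j ∈ 𝔍_β`. -/
def gcdMinors (A : Matrix (Fin d) (Fin n) ℤ) (B : Matrix (Fin n) (Fin 2) ℤ)
    (β : Set (Fin d → ℝ)) : ℤ :=
  (Finset.univ : Finset (GaleIndex A β × GaleIndex A β)).gcd
    fun p => det2 (galeRows A B β p.1) (galeRows A B β p.2)

end Gale

/-- `|T(M/L)|` for `M = ℤ^σ` and `L = ℤB`. -/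
def torsionOrder {σ τ : Type} (B : Matrix σ τ ℤ) : ℕ :=
  Nat.card (Submodule.torsion ℤ ((σ → ℤ) ⧸ columnLattice B))

/-! ### Lattice ideals and degrees -/

section Degree

variable {σ : Type} [Fintype σ]

/-- The monomial `x^(l⁺)`, where `l⁺` is the positive part of `l`. -/
def posMonomial (l : σ → ℤ) : MvPolynomial σ ℂ :=
  MvPolynomial.monomial (Finsupp.equivFunOnFinite.symm fun i => (l i).toNat) 1

/-- The lattice ideal `I_B`, generated by the binomials `x^(l⁺) - x^(l⁻)` with `l ∈ ℤB`. -/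
def latticeIdeal {τ : Type} (B : Matrix σ τ ℤ) : Ideal (MvPolynomial σ ℂ) :=
  Ideal.span {f | ∃ l ∈ columnLattice B, f = posMonomial l - posMonomial (-l)}

/-- The Hilbert function of `I`: the dimension of the degree `t` part of `ℂ[x]/I`. -/
def hilbertFunction (I : Ideal (MvPolynomial σ ℂ)) (t : ℕ) : ℕ :=
  Module.finrank ℂ ((MvPolynomial.homogeneousSubmodule σ ℂ t).map
    (Ideal.Quotient.mkₐ ℂ I).toLinearMap)

/-- `p` is the Hilbert polynomial of `I`. -/
def IsHilbertPolynomial (I : Ideal (MvPolynomial σ ℂ)) (p : Polynomial ℚ) : Prop :=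
  ∀ᶠ t : ℕ in Filter.atTop, p.eval (t : ℚ) = hilbertFunction I t

open Classical in
/-- The Hilbert polynomial of a homogeneous ideal `I`. -/
def hilbertPolynomial (I : Ideal (MvPolynomial σ ℂ)) : Polynomial ℚ :=
  if h : ∃ p, IsHilbertPolynomial I p then h.choose else 0

open Classical in
/-- The degree of a homogeneous ideal `I`: `e!` times the leading coefficient of the Hilbert
polynomial, `e` being its degree, and the length of `ℂ[x]/I` if the Hilbert polynomial is zero. -/
def degree (I : Ideal (MvPolynomial σ ℂ)) : ℚ :=
  if hilbertPolynomial I = 0 then Module.finrank ℂ (MvPolynomial σ ℂ ⧸ I)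
  else (hilbertPolynomial I).natDegree.factorial * (hilbertPolynomial I).leadingCoeff

end Degree

end ToricGale

end

noncomputable section

namespace ToricGale

open Filter Topology Polynomial

/-! Let `L = ℤA/(ℤA ∩ ℝβ)`, and let `π` send the unit vector `e_i` to the class of `a_i`, for the
columns `a_i` outside `β`. By Gale duality, `y` lies in `ℤB_β` exactly when `∑ y_i a_i ∈ ℤβ`,
whereas `ker π` only asks that `∑ y_i a_i ∈ ℝβ`. So `ker π` is the saturation of `ℤB_β`
(`isSaturationOf_ker_quotientMap`), and the index of `ℤB_β` in it is `i(P, β)`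
(`latticeIndex_eq_relIndex`). Appending the row `w_β` embeds the picture into the vectors of sum
zero, so the same index is the order of the torsion `T` of `ℤ^(r+1)/ℤB'_β`. It is also the gcd of
the minors, because a saturated lattice of rank two has coprime minors. The rank is two because
otherwise all rows of `B_β` lie on one line, and a positive relation among them makes that line
relevant.

Both volumes come from one asymptotic count, `tendsto_classCount`: if `Λ` has finite index `h` in
the degree-zero part of `ker φ`, and `c` generates the degrees occurring on `ker φ`, then `c` times
the number of classes modulo `Λ` of monomials of degree `t` grows like `h · vol(Conv{φ(e_i)}) ·
t^m`.

With the origin: take `Λ = ℤB'_β`, the additional unit vector going to `0`. Then `c = 1`, `h = |T|`,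
and the count is the Hilbert function of the lattice ideal, so the normalised volume is its degree
divided by `|T|`.

Without the origin: if `w_β ≠ 0`, the degree-zero part of `ker π` is generated by a single `v`, and
`h = 1`. The classes are counted as on the hypersurface `x^(v⁺) = x^(v⁻)` of degree `∑ v_i⁺`, so the
normalised volume is `c ∑ v_i⁺`. The identity `det(w_β, b_j) = |T| c v_j` turns this into the second
term. If `w_β = 0`, the points lie on a hyperplane and both sides vanish. -/

/-! ### Eventually polynomial functions and lower sets of `ℕ^k` -/

/-- `f` agrees with a polynomial at all large arguments. -/
def EventuallyPolynomial (f : ℕ → ℚ) : Prop :=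
  ∃ p : ℚ[X], ∀ᶠ t : ℕ in atTop, p.eval (t : ℚ) = f t

theorem EventuallyPolynomial.add {f g : ℕ → ℚ} (hf : EventuallyPolynomial f)
    (hg : EventuallyPolynomial g) : EventuallyPolynomial fun t => f t + g t := by
  obtain ⟨p, hp⟩ := hf
  obtain ⟨q, hq⟩ := hg
  refine ⟨p + q, ?_⟩
  filter_upwards [hp, hq] with t h1 h2
  rw [eval_add, h1, h2]

theorem EventuallyPolynomial.of_shift {f : ℕ → ℚ}
    (hf : EventuallyPolynomial fun t => f (t + 1)) : EventuallyPolynomial f := by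
  obtain ⟨p, hp⟩ := hf
  refine ⟨p.comp (X - 1), ?_⟩
  obtain ⟨N, hN⟩ := eventually_atTop.1 hp
  filter_upwards [eventually_ge_atTop (N + 1)] with t ht
  obtain ⟨s, rfl⟩ : ∃ s, t = s + 1 := ⟨t - 1, by omega⟩
  have h := hN s (by omega)
  simp only at h
  rw [← h]
  simp

theorem EventuallyPolynomial.shift {f : ℕ → ℚ} (hf : EventuallyPolynomial f) :
    EventuallyPolynomial fun t => f (t + 1) := by
  obtain ⟨p, hp⟩ := hf
  refine ⟨p.comp (X + 1), ?_⟩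
  filter_upwards [(tendsto_add_atTop_nat 1).eventually hp] with t ht
  rw [← ht]
  simp

theorem exists_antidifference (p : ℚ[X]) :
    ∃ q : ℚ[X], ∀ x : ℚ, q.eval (x + 1) = q.eval x + p.eval x := by
  induction p using Polynomial.induction_on' with
  | add p₁ p₂ h₁ h₂ =>
    obtain ⟨q₁, h₁⟩ := h₁
    obtain ⟨q₂, h₂⟩ := h₂
    exact ⟨q₁ + q₂, fun x => by rw [eval_add, eval_add, eval_add, h₁, h₂]; ring⟩
  | monomial n a =>
    -- The Bernoulli polynomials satisfy `B_(n+1)(x + 1) - B_(n+1)(x) = (n + 1) x^n`.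
    refine ⟨C (a / (n + 1)) * Polynomial.bernoulli (n + 1), fun x => ?_⟩
    have h : (n + 1 : ℚ) ≠ 0 := by positivity
    rw [add_comm x 1, eval_mul, eval_mul, bernoulli_eval_one_add, eval_monomial, eval_C]
    push_cast
    rw [eval_C]
    field_simp

theorem EventuallyPolynomial.of_difference {f g : ℕ → ℚ} (hg : EventuallyPolynomial g)
    (h : ∀ t, f (t + 1) = f t + g t) : EventuallyPolynomial f := by
  obtain ⟨p, hp⟩ := hg
  obtain ⟨q, hq⟩ := exists_antidifference p
  obtain ⟨N, hN⟩ := eventually_atTop.1 hp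
  refine ⟨q + C (f N - q.eval (N : ℚ)), ?_⟩
  filter_upwards [eventually_ge_atTop N] with t ht
  induction t, ht using Nat.le_induction with
  | base => simp
  | succ t ht ih =>
    rw [h, ← ih, ← hN t ht, eval_add, eval_add, Nat.cast_succ, hq, eval_C, eval_C]
    ring

open Classical in
/-- The number of points of coordinate sum `t` in `D`. -/
def degreeCount {k : ℕ} (D : Set (Fin k → ℕ)) (t : ℕ) : ℕ :=
  ((Finset.piAntidiag Finset.univ t).filter (· ∈ D)).card

/-- The slice of `D` at first coordinate `j`. -/
def slice {k : ℕ} (D : Set (Fin (k + 1) → ℕ)) (j : ℕ) : Set (Fin k → ℕ) :=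
  {x | (Fin.cons j x : Fin (k + 1) → ℕ) ∈ D}

/-- The points of `D` with first coordinate at least `j`, translated by `-j`. -/
def translate {k : ℕ} (D : Set (Fin (k + 1) → ℕ)) (j : ℕ) : Set (Fin (k + 1) → ℕ) :=
  {x | (Fin.cons (x 0 + j) (Fin.tail x) : Fin (k + 1) → ℕ) ∈ D}

theorem degreeCount_succ {k : ℕ} (D : Set (Fin (k + 1) → ℕ)) (t : ℕ) :
    degreeCount D (t + 1) = degreeCount (slice D 0) (t + 1) + degreeCount (translate D 1) t := by
  classical
  let f : (Fin k → ℕ) → (Fin (k + 1) → ℕ) := fun x => Fin.cons 0 x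
  let g : (Fin (k + 1) → ℕ) → (Fin (k + 1) → ℕ) := fun x => Fin.cons (x 0 + 1) (Fin.tail x)
  have hf : Function.Injective f := fun x y h => by simpa [f] using h
  have hg : Function.Injective g := by
    intro x y h
    have h0 := congrFun h 0
    funext i
    refine Fin.cases ?_ (fun i => ?_) i
    · simpa [g] using h0
    · simpa [g, Fin.tail] using congrFun h i.succ
  unfold degreeCount
  rw [← Finset.card_image_of_injective _ hf, ← Finset.card_image_of_injective (Finset.filter (· ∈ translate D 1) _) hg,
    ← Finset.card_union_of_disjoint]
  · congr 1
    ext x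
    simp only [Finset.mem_filter, Finset.mem_piAntidiag, Finset.mem_union, Finset.mem_image,
      Finset.mem_univ, implies_true, and_true]
    constructor
    · rintro ⟨hs, hx⟩
      rcases Nat.eq_zero_or_pos (x 0) with h0 | h0
      · left
        have hx' : f (Fin.tail x) = x := by
          rw [← Fin.cons_self_tail x, h0]; rfl
        refine ⟨Fin.tail x, ⟨?_, ?_⟩, hx'⟩
        · rw [Fin.sum_univ_succ, h0, zero_add] at hs; exact hs
        · change f _ ∈ D; rwa [hx']
      · right
        have hx' : g (Fin.cons (x 0 - 1) (Fin.tail x)) = x := by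
          simp only [g, Fin.cons_zero, Fin.tail_cons]
          rw [Nat.sub_add_cancel h0]
          exact Fin.cons_self_tail x
        refine ⟨Fin.cons (x 0 - 1) (Fin.tail x), ⟨?_, ?_⟩, hx'⟩
        · rw [Fin.sum_univ_succ] at hs ⊢
          simp only [Fin.cons_zero, Fin.cons_succ, Fin.tail]
          omega
        · change g _ ∈ D; rwa [hx']
    · rintro (⟨y, ⟨hs, hy⟩, rfl⟩ | ⟨y, ⟨hs, hy⟩, rfl⟩)
      · exact ⟨by simp [f, Fin.sum_univ_succ, hs], hy⟩
      · refine ⟨?_, hy⟩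
        rw [Fin.sum_univ_succ] at hs ⊢
        simp only [Fin.cons_zero, Fin.cons_succ, Fin.tail]
        omega
  · rw [Finset.disjoint_left]
    intro x h1 h2
    simp only [Finset.mem_image] at h1 h2
    obtain ⟨y, -, rfl⟩ := h1
    obtain ⟨z, -, hz⟩ := h2
    simpa [f, g] using congrFun hz 0

theorem slice_translate {k : ℕ} (D : Set (Fin (k + 1) → ℕ)) (i j : ℕ) :
    slice (translate D j) i = slice D (i + j) := by
  ext x
  simp [slice, translate]

theorem translate_translate {k : ℕ} (D : Set (Fin (k + 1) → ℕ)) (i j : ℕ) :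
    translate (translate D j) i = translate D (i + j) := by
  ext x
  simp [translate, add_assoc]

/-- Dickson's lemma: the points that leave the sequence at some stage form a set with finitely many
minimal elements. Once these have all left, so has everything above them. -/
theorem exists_stable_of_antitone {k : ℕ} (E : ℕ → Set (Fin k → ℕ)) (hE : Antitone E)
    (hlow : ∀ j, IsLowerSet (E j)) : ∃ J, ∀ j, J ≤ j → E j = E J := by
  set U : Set (Fin k → ℕ) := {x | ∃ j, x ∉ E j} with hU
  have hpwo : U.IsPWO := Set.isPWO_of_wellQuasiOrderedLE U
  have hfin : {x | Minimal (· ∈ U) x}.Finite :=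
    (setOfPred_minimal_antichain _).finite_of_partiallyWellOrderedOn
      (hpwo.mono (setOfPred_minimal_subset _))
  have hj : ∀ x : Fin k → ℕ, ∃ j, Minimal (· ∈ U) x → x ∉ E j := by
    intro x
    by_cases hx : Minimal (· ∈ U) x
    · obtain ⟨j, hj⟩ := hx.1
      exact ⟨j, fun _ => hj⟩
    · exact ⟨0, fun h => absurd h hx⟩
  choose g hg using hj
  refine ⟨hfin.toFinset.sup g, fun j hJj => (hE hJj).antisymm fun x hx => ?_⟩
  by_contra hxj
  obtain ⟨z, hzx, hz⟩ := hpwo.exists_le_minimal (show x ∈ U from ⟨j, hxj⟩)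
  refine hg z hz (hE ?_ (hlow _ hzx hx))
  exact Finset.le_sup (f := g) (hfin.mem_toFinset.2 hz)

/-- Induction on the dimension. The slices decrease and are constant from some `J` on. The part of
`D` beyond `J` is then invariant under a further shift, so the first difference of its count is a
count in one dimension less. The slices below `J` are added back one at a time, descending from `J`
to `0`. -/
theorem eventuallyPolynomial_degreeCount {k : ℕ} (D : Set (Fin k → ℕ)) (hD : IsLowerSet D) :
    EventuallyPolynomial fun t => degreeCount D t := by
  induction k with
  | zero =>
    refine ⟨0, ?_⟩
    filter_upwards [eventually_gt_atTop 0] with t ht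
    simp [degreeCount, ht.ne']
  | succ k ih =>
    have hslice : ∀ j, IsLowerSet (slice D j) := fun j x y hyx hx =>
      hD (show (Fin.cons j y : Fin (k + 1) → ℕ) ≤ Fin.cons j x from by
        simpa [Fin.cons_le_cons] using hyx) hx
    have hanti : Antitone (slice D) := fun i j hij x hx =>
      hD (show (Fin.cons i x : Fin (k + 1) → ℕ) ≤ Fin.cons j x from by
        simpa [Fin.cons_le_cons] using hij) hx
    obtain ⟨J, hJ⟩ := exists_stable_of_antitone _ hanti hslice
    have hcount : ∀ j t, (degreeCount (translate D j) (t + 1) : ℚ) =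
        degreeCount (translate D (j + 1)) t + degreeCount (slice D j) (t + 1) := by
      intro j t
      rw [degreeCount_succ, slice_translate, translate_translate, zero_add, add_comm 1 j]
      push_cast
      ring
    have hstable : translate D (J + 1) = translate D J := by
      ext x
      change Fin.tail x ∈ slice D _ ↔ Fin.tail x ∈ slice D _
      rw [hJ _ (by omega), hJ (x 0 + J) (by omega)]
    have key : ∀ i, i ≤ J → EventuallyPolynomial fun t => degreeCount (translate D (J - i)) t := by
      intro i
      induction i with
      | zero =>
        intro _
        refine (ih (slice D J) (hslice J)).shift.of_difference fun t => ?_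
        rw [Nat.sub_zero, hcount, hstable]
      | succ i ihi =>
        intro hi
        refine EventuallyPolynomial.of_shift ?_
        have h := (ihi (by omega)).add (ih (slice D (J - (i + 1))) (hslice _)).shift
        convert h using 2 with t
        rw [hcount, show J - (i + 1) + 1 = J - i by omega]
    have h := key J le_rfl
    rw [Nat.sub_self] at h
    convert h using 4
    ext x
    change _ ↔ (Fin.cons (x 0 + 0) (Fin.tail x) : Fin (k + 1) → ℕ) ∈ D
    rw [add_zero, Fin.cons_self_tail]

/-! ### Classes of monomials modulo a lattice -/

section ClassCount

variable {σ : Type}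

/-- The class of the exponent vector `x` in `ℤ^σ / Λ`. -/
def natClass (Λ : Submodule ℤ (σ → ℤ)) (x : σ → ℕ) : (σ → ℤ) ⧸ Λ :=
  Submodule.Quotient.mk fun i => (x i : ℤ)

theorem natClass_eq_iff (Λ : Submodule ℤ (σ → ℤ)) (x y : σ → ℕ) :
    natClass Λ x = natClass Λ y ↔ (fun i => (x i : ℤ) - y i) ∈ Λ :=
  Submodule.Quotient.eq Λ

theorem natClass_add (Λ : Submodule ℤ (σ → ℤ)) (x y : σ → ℕ) :
    natClass Λ (x + y) = natClass Λ x + natClass Λ y := by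
  unfold natClass
  rw [← Submodule.Quotient.mk_add]
  congr 1

variable [Fintype σ]

/-- The classes in `ℤ^σ / Λ` of the exponent vectors of degree `t`. -/
def classSet (Λ : Submodule ℤ (σ → ℤ)) (t : ℕ) : Set ((σ → ℤ) ⧸ Λ) :=
  natClass Λ '' {x | ∑ i, x i = t}

/-- The number of classes of monomials of degree `t` modulo `Λ`. -/
def classCount (Λ : Submodule ℤ (σ → ℤ)) (t : ℕ) : ℕ :=
  (classSet Λ t).ncard

theorem finite_sum_eq (t : ℕ) : {x : σ → ℕ | ∑ i, x i = t}.Finite := by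
  classical
  refine (Finset.piAntidiag Finset.univ t).finite_toSet.subset fun x hx => ?_
  simpa using hx

theorem finite_classSet (Λ : Submodule ℤ (σ → ℤ)) (t : ℕ) : (classSet Λ t).Finite :=
  (finite_sum_eq t).image _

/-- For a lattice of vectors with coordinate sum zero, the lexicographically smallest exponent
vectors in their classes form a lower set, so that the number of classes of degree `t` is
eventually a polynomial in `t`. -/
theorem eventuallyPolynomial_classCount (Λ : Submodule ℤ (σ → ℤ))
    (hΛ : ∀ l ∈ Λ, ∑ i, l i = 0) : EventuallyPolynomial fun t => classCount Λ t := by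
  classical
  let e := Fintype.equivFin σ
  let c : (Fin (Fintype.card σ) → ℕ) → (σ → ℤ) ⧸ Λ := fun x => natClass Λ (x ∘ e)
  have hc : ∀ x y, c (x + y) = c x + c y := fun x y => natClass_add Λ _ _
  -- The standard monomials: the order is total and compatible with addition, so a divisor of the
  -- minimum of its class is again a minimum.
  let D : Set (Fin (Fintype.card σ) → ℕ) := {x | ∀ y, c y = c x → toLex x ≤ toLex y}
  have hD : IsLowerSet D := by
    intro x z hzx hx y hy
    have hxz : z + (x - z) = x := by
      funext i
      exact Nat.add_sub_cancel' (hzx i)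
    have h := hx (y + (x - z)) (by rw [hc, hy, ← hc, hxz])
    rw [← hxz] at h
    exact le_of_add_le_add_right (a := toLex (x - z)) (by simpa using h)
  have hsum : ∀ x : Fin (Fintype.card σ) → ℕ, ∑ i, (x ∘ e) i = ∑ i, x i := fun x =>
    Equiv.sum_comp e x
  convert eventuallyPolynomial_degreeCount D hD using 3 with t
  unfold classCount degreeCount
  rw [← Set.ncard_coe_finset]
  symm
  refine Set.ncard_congr (fun x _ => c x) ?_ ?_ ?_
  · intro x hx
    simp only [Finset.coe_filter, Finset.mem_piAntidiag, Set.mem_ofPred_eq] at hx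
    exact ⟨x ∘ e, by rw [Set.mem_ofPred_eq, hsum]; exact hx.1.1, rfl⟩
  · intro x y hx hy hxy
    simp only [Finset.coe_filter, Set.mem_ofPred_eq] at hx hy
    exact toLex.injective ((hx.2 y hxy.symm).antisymm (hy.2 x hxy))
  · rintro _ ⟨x, hx, rfl⟩
    let S : Set (Lex (Fin (Fintype.card σ) → ℕ)) := {y | c (ofLex y) = natClass Λ x}
    have hS : S.Nonempty := ⟨toLex (x ∘ e.symm), by
      change natClass Λ ((x ∘ e.symm) ∘ e) = natClass Λ x
      rw [Function.comp_assoc, Equiv.symm_comp_self, Function.comp_id]⟩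
    let y := wellFounded_lt.min S hS
    have hy : c (ofLex y) = natClass Λ x := wellFounded_lt.min_mem S hS
    refine ⟨ofLex y, ?_, hy⟩
    simp only [Finset.coe_filter, Finset.mem_piAntidiag, Finset.mem_univ, implies_true, and_true,
      Set.mem_ofPred_eq]
    constructor
    -- Congruent exponent vectors have equal degree, so passing to the minimum stays in degree `t`.
    · have h := hΛ _ ((natClass_eq_iff Λ _ _).1 hy)
      rw [Finset.sum_sub_distrib, sub_eq_zero] at h
      have h' : ∑ i, (ofLex y ∘ e) i = ∑ i, x i := by exact_mod_cast h
      rw [← hsum, h']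
      exact hx
    · intro z hz
      exact le_of_not_gt (wellFounded_lt.not_lt_min S (show c (ofLex (toLex z)) = _ from hz.trans hy))

end ClassCount

/-! ### The Hilbert function of a lattice ideal -/

section Hilbert

variable {σ τ : Type} [Fintype σ]

/-- Dividing by the common factor `x^(a ⊓ b)` leaves one of the generating binomials. -/
theorem monomial_sub_mem_latticeIdeal (B : Matrix σ τ ℤ) (a b : σ →₀ ℕ)
    (h : (fun i => (a i : ℤ) - b i) ∈ columnLattice B) :
    MvPolynomial.monomial a (1 : ℂ) - MvPolynomial.monomial b 1 ∈ latticeIdeal B := by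
  have key : ∀ a b : σ →₀ ℕ, MvPolynomial.monomial a (1 : ℂ) =
      MvPolynomial.monomial (a ⊓ b) 1 * posMonomial fun i => (a i : ℤ) - b i := by
    intro a b
    rw [posMonomial, MvPolynomial.monomial_mul, one_mul]
    refine congrArg (fun z => MvPolynomial.monomial z (1 : ℂ)) (Finsupp.ext fun i => ?_)
    simp only [Finsupp.add_apply, Finsupp.inf_apply, Finsupp.equivFunOnFinite_symm_apply_apply]
    rcases le_total (a i) (b i) with h | h
    · rw [inf_eq_left.2 h]; omega
    · rw [inf_eq_right.2 h]; omega
  have hneg : (fun i => (b i : ℤ) - a i) = -fun i => (a i : ℤ) - b i := by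
    funext i
    rw [Pi.neg_apply, neg_sub]
  rw [key a b, key b a, inf_comm b a, hneg, ← mul_sub]
  exact Ideal.mul_mem_left _ _ (Ideal.subset_span ⟨_, h, rfl⟩)

/-- The homomorphism `ℂ[x] / I_B → ℂ[ℤ^σ / ℤB]`. -/
theorem exists_latticeIdeal_hom (B : Matrix σ τ ℤ) :
    ∃ Ψ : (MvPolynomial σ ℂ ⧸ latticeIdeal B) →ₗ[ℂ]
      AddMonoidAlgebra ℂ ((σ → ℤ) ⧸ columnLattice B),
      ∀ a : σ →₀ ℕ, Ψ (Ideal.Quotient.mk _ (MvPolynomial.monomial a 1)) =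
        AddMonoidAlgebra.single (natClass (columnLattice B) a) 1 := by
  let f : (σ →₀ ℕ) →+ (σ → ℤ) ⧸ columnLattice B :=
    { toFun := fun a => natClass (columnLattice B) a
      map_zero' := by
        unfold natClass
        exact congrArg _ (by funext i; simp : (fun i => (((0 : σ →₀ ℕ) i : ℕ) : ℤ)) = 0)
      map_add' := fun a b => by rw [Finsupp.coe_add, natClass_add] }
  let Φ : MvPolynomial σ ℂ →ₐ[ℂ] AddMonoidAlgebra ℂ ((σ → ℤ) ⧸ columnLattice B) :=
    AddMonoidAlgebra.mapDomainAlgHom ℂ ℂ f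
  have hΦ : ∀ a : σ →₀ ℕ, Φ (MvPolynomial.monomial a 1) =
      AddMonoidAlgebra.single (natClass (columnLattice B) a) 1 := fun a =>
    AddMonoidAlgebra.mapDomain_single
  have hI : ∀ p ∈ latticeIdeal B, Φ p = 0 := by
    intro p hp
    have hle : latticeIdeal B ≤ RingHom.ker Φ := by
      refine Ideal.span_le.2 ?_
      rintro _ ⟨l, hl, rfl⟩
      rw [SetLike.mem_coe, RingHom.mem_ker, map_sub, sub_eq_zero, posMonomial, posMonomial, hΦ, hΦ]
      congr 1
      rw [natClass_eq_iff]
      convert hl using 1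
      funext i
      simp only [Finsupp.equivFunOnFinite_symm_apply_apply, Pi.neg_apply]
      omega
    exact hle hp
  exact ⟨(Ideal.Quotient.liftₐ _ Φ hI).toLinearMap, fun a => hΦ a⟩

/-- Congruent monomials agree modulo the ideal, so one representative per class spans. The map to
the group algebra sends these representatives to distinct basis elements, so they are independent.
-/
theorem hilbertFunction_latticeIdeal (B : Matrix σ τ ℤ) (t : ℕ) :
    hilbertFunction (latticeIdeal B) t = classCount (columnLattice B) t := by
  classical
  obtain ⟨Ψ, hΨ⟩ := exists_latticeIdeal_hom B
  have hrep : ∀ g : classSet (columnLattice B) t, ∃ a : σ →₀ ℕ,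
      a.degree = t ∧ natClass (columnLattice B) a = g := by
    rintro ⟨_, x, hx, rfl⟩
    exact ⟨Finsupp.equivFunOnFinite.symm x, by simpa [Finsupp.degree_eq_sum] using hx, rfl⟩
  choose rep hdeg hcl using hrep
  let b : classSet (columnLattice B) t → MvPolynomial σ ℂ ⧸ latticeIdeal B := fun g =>
    Ideal.Quotient.mk _ (MvPolynomial.monomial (rep g) 1)
  have hb : LinearIndependent ℂ b := by
    refine LinearIndependent.of_comp Ψ ?_
    have h : Ψ ∘ b = fun g : classSet (columnLattice B) t =>
        AddMonoidAlgebra.single (g : (σ → ℤ) ⧸ columnLattice B) (1 : ℂ) := by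
      funext g
      rw [Function.comp_apply, hΨ, hcl]
    rw [h]
    refine LinearIndependent.of_comp (AddMonoidAlgebra.coeffLinearEquiv ℂ).toLinearMap ?_
    exact (Finsupp.linearIndependent_single_one ℂ _).comp _ Subtype.val_injective
  have hspan : (MvPolynomial.homogeneousSubmodule σ ℂ t).map
      (Ideal.Quotient.mkₐ ℂ (latticeIdeal B)).toLinearMap = Submodule.span ℂ (Set.range b) := by
    rw [MvPolynomial.homogeneousSubmodule_eq_finsupp_supported,
      AddMonoidAlgebra.supported_eq_span_single, Submodule.map_span]
    congr 1
    ext q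
    constructor
    · rintro ⟨_, ⟨a, ha, rfl⟩, rfl⟩
      have hmem : natClass (columnLattice B) a ∈ classSet (columnLattice B) t :=
        ⟨a, by rw [← ha, Finsupp.degree_eq_sum]; rfl, rfl⟩
      refine ⟨⟨_, hmem⟩, ?_⟩
      refine Ideal.Quotient.eq.2 (monomial_sub_mem_latticeIdeal B _ _ ?_)
      exact (natClass_eq_iff _ _ _).1 (hcl ⟨_, hmem⟩)
    · rintro ⟨g, rfl⟩
      exact ⟨MvPolynomial.monomial (rep g) 1, ⟨rep g, hdeg g, rfl⟩, rfl⟩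
  have := (finite_classSet (columnLattice B) t).fintype
  rw [hilbertFunction, hspan, finrank_span_eq_card hb, classCount, ← Nat.card_coe_set_eq,
    Nat.card_eq_fintype_card]

end Hilbert

/-! ### Counting classes of monomials by lattice points of a polytope -/

theorem castVec_apply {m : ℕ} (y : Fin m → ℤ) (k : Fin m) : castVec y k = (y k : ℝ) := rfl

theorem castVec_injective {m : ℕ} : Function.Injective (castVec (m := m)) := fun _ _ h =>
  funext fun k => Int.cast_injective (α := ℝ) (congrFun h k)

/-- The sum of the coordinates. -/
def coordSum (σ : Type) [Fintype σ] : (σ → ℤ) →ₗ[ℤ] ℤ := ∑ i, LinearMap.proj i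

theorem coordSum_apply {σ : Type} [Fintype σ] (x : σ → ℤ) : coordSum σ x = ∑ i, x i := by
  simp [coordSum]

/-- The lattice points of the `t`-th dilate of the convex hull of the points `p i`. -/
def dilatePoints {σ : Type} [Fintype σ] {m : ℕ} (p : σ → Fin m → ℤ) (t : ℕ) : Set (Fin m → ℤ) :=
  {y | ∃ w : σ → ℝ, (∀ i, 0 ≤ w i) ∧ ∑ i, w i = t ∧ ∑ i, w i • castVec (p i) = castVec y}

theorem finite_of_abs_le {m : ℕ} {S : Set (Fin m → ℤ)} (C : Fin m → ℤ)
    (h : ∀ y ∈ S, ∀ k, |y k| ≤ C k) : S.Finite :=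
  (Set.finite_Icc (-C) C).subset fun y hy =>
    ⟨fun k => (abs_le.1 (h y hy k)).1, fun k => (abs_le.1 (h y hy k)).2⟩

theorem abs_sum_smul_le {σ : Type} [Fintype σ] {m : ℕ} (p : σ → Fin m → ℤ) (w : σ → ℝ) (R : ℕ)
    (h0 : ∀ i, 0 ≤ w i) (hR : ∀ i, w i ≤ R) (k : Fin m) :
    |(∑ i, w i • castVec (p i)) k| ≤ ((R * ∑ i, |p i k| : ℤ) : ℝ) := by
  rw [Finset.sum_apply]
  refine (Finset.abs_sum_le_sum_abs _ _).trans ?_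
  push_cast
  rw [Finset.mul_sum]
  refine Finset.sum_le_sum fun i _ => ?_
  rw [Pi.smul_apply, smul_eq_mul, abs_mul, abs_of_nonneg (h0 i), castVec_apply]
  exact mul_le_mul_of_nonneg_right (hR i) (abs_nonneg _)

theorem finite_dilatePoints {σ : Type} [Fintype σ] {m : ℕ} (p : σ → Fin m → ℤ) (t : ℕ) :
    (dilatePoints p t).Finite := by
  refine finite_of_abs_le (fun k => t * ∑ i, |p i k|) ?_
  rintro y ⟨w, h0, ht, hy⟩ k
  have h := abs_sum_smul_le p w t h0
    (fun i => ht ▸ Finset.single_le_sum (fun j _ => h0 j) (Finset.mem_univ i)) k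
  rw [hy, castVec_apply] at h
  exact_mod_cast h

theorem mem_convexHull_range_iff {σ E : Type*} [Fintype σ] [AddCommGroup E] [Module ℝ E]
    (p : σ → E) (x : E) :
    x ∈ convexHull ℝ (Set.range p) ↔
      ∃ w : σ → ℝ, (∀ i, 0 ≤ w i) ∧ ∑ i, w i = 1 ∧ ∑ i, w i • p i = x := by
  classical
  constructor
  · intro hx
    refine convexHull_min (t := {x | ∃ w : σ → ℝ, (∀ i, 0 ≤ w i) ∧ ∑ i, w i = 1 ∧
      ∑ i, w i • p i = x}) ?_ ?_ hx
    · rintro _ ⟨i, rfl⟩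
      refine ⟨Pi.single i 1, fun j => ?_, by simp, by simp [Pi.single_apply, ite_smul]⟩
      by_cases h : j = i
      · subst h; simp
      · simp [Pi.single_eq_of_ne h]
    · rintro _ ⟨w, hw, hw1, rfl⟩ _ ⟨v, hv, hv1, rfl⟩ a b ha hb hab
      refine ⟨fun i => a * w i + b * v i, fun i => add_nonneg (mul_nonneg ha (hw i))
        (mul_nonneg hb (hv i)), ?_, ?_⟩
      · rw [Finset.sum_add_distrib, ← Finset.mul_sum, ← Finset.mul_sum, hw1, hv1, mul_one, mul_one,
          hab]
      · simp only [add_smul, mul_smul, Finset.sum_add_distrib, Finset.smul_sum]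
  · rintro ⟨w, hw, hw1, rfl⟩
    exact (convex_convexHull ℝ _).sum_mem (fun i _ => hw i) hw1
      fun i _ => subset_convexHull ℝ _ ⟨i, rfl⟩

theorem mem_dilatePoints_iff {σ : Type} [Fintype σ] {m : ℕ} (p : σ → Fin m → ℤ) (t : ℕ)
    (ht : 0 < t) (y : Fin m → ℤ) :
    y ∈ dilatePoints p t ↔
      (t : ℝ)⁻¹ • castVec y ∈ convexHull ℝ (Set.range fun i => castVec (p i)) := by
  have ht' : (t : ℝ) ≠ 0 := by positivity
  rw [mem_convexHull_range_iff]
  constructor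
  · rintro ⟨w, hw, hwt, hwy⟩
    refine ⟨fun i => (t : ℝ)⁻¹ * w i, fun i => mul_nonneg (by positivity) (hw i), ?_, ?_⟩
    · rw [← Finset.mul_sum, hwt, inv_mul_cancel₀ ht']
    · simp only [mul_smul, ← Finset.smul_sum, hwy]
  · rintro ⟨w, hw, hwt, hwy⟩
    refine ⟨fun i => (t : ℝ) * w i, fun i => mul_nonneg (by positivity) (hw i), ?_, ?_⟩
    · rw [← Finset.mul_sum, hwt, mul_one]
    · simp only [mul_smul, ← Finset.smul_sum, hwy, smul_inv_smul₀ ht']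

/-- The number of lattice points of the dilates of a lattice polytope is asymptotically given by
its volume. -/
theorem tendsto_ncard_dilatePoints {σ : Type} [Fintype σ] {m : ℕ} (p : σ → Fin m → ℤ) :
    Tendsto (fun t : ℕ => ((dilatePoints p t).ncard : ℝ) / (t : ℝ) ^ m) atTop
      (𝓝 (MeasureTheory.volume (convexHull ℝ (Set.range fun i => castVec (p i)))).toReal) := by
  set Q := convexHull ℝ (Set.range fun i => castVec (p i)) with hQ
  have hcomp : IsCompact Q := (Set.finite_range _).isCompact_convexHull ℝ
  have h := tendsto_card_div_pow_atTop_volume Q hcomp.isBounded hcomp.isClosed.measurableSet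
    ((convex_convexHull ℝ _).addHaar_frontier _)
  rw [Fintype.card_fin] at h
  refine h.congr' ?_
  filter_upwards [eventually_gt_atTop 0] with t ht
  have ht' : (t : ℝ) ≠ 0 := by positivity
  congr 2
  rw [Nat.card_coe_set_eq]
  symm
  refine Set.ncard_congr (fun y _ => (t : ℝ)⁻¹ • castVec y) ?_ ?_ ?_
  · intro y hy
    refine ⟨(mem_dilatePoints_iff p t ht y).1 hy, Set.smul_mem_smul_set ?_⟩
    exact (Module.Basis.mem_span_iff_repr_mem ℤ _ _).2 fun k => ⟨y k, by simp [castVec_apply]⟩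
  · intro x y _ _ hxy
    exact castVec_injective (smul_right_injective _ (inv_ne_zero ht') hxy)
  · rintro _ ⟨hz, z, hzL, rfl⟩
    obtain ⟨y, rfl⟩ : ∃ y : Fin m → ℤ, castVec y = z := by
      have hk := (Module.Basis.mem_span_iff_repr_mem ℤ _ _).1 hzL
      choose y hy using hk
      exact ⟨y, funext fun k => by simpa [castVec_apply] using hy k⟩
    exact ⟨y, (mem_dilatePoints_iff p t ht y).2 hz, rfl⟩

/-- The bounds on the number of classes hold only up to a fixed shift of `t`. Such shifts are
harmless since `((t + a)/t)^m → 1`. -/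
theorem tendsto_div_pow_shift {f : ℕ → ℝ} {m : ℕ} {V : ℝ} (a : ℕ) :
    Tendsto (fun t => f (t + a) / (t : ℝ) ^ m) atTop (𝓝 V) ↔
      Tendsto (fun t => f t / (t : ℝ) ^ m) atTop (𝓝 V) := by
  have hr : Tendsto (fun t : ℕ => (((t + a : ℕ) : ℝ) / t) ^ m) atTop (𝓝 1) := by
    have h1 : Tendsto (fun t : ℕ => 1 + (a : ℝ) / t) atTop (𝓝 (1 + 0)) :=
      tendsto_const_nhds.add (tendsto_const_div_atTop_nhds_zero_nat _)
    have h2 := (h1.congr' (f₂ := fun t : ℕ => ((t + a : ℕ) : ℝ) / t) ?_).pow m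
    · simpa using h2
    · filter_upwards [eventually_gt_atTop 0] with t ht
      have : (t : ℝ) ≠ 0 := by positivity
      push_cast
      field_simp
  rw [← tendsto_add_atTop_iff_nat (f := fun t => f t / (t : ℝ) ^ m) a]
  constructor
  · intro h
    have h' := h.mul (hr.inv₀ one_ne_zero)
    rw [inv_one, mul_one] at h'
    refine h'.congr' ?_
    filter_upwards [eventually_gt_atTop 0] with t ht
    have h1 : (t : ℝ) ≠ 0 := by positivity
    have h2 : ((t + a : ℕ) : ℝ) ≠ 0 := by positivity
    rw [div_pow]
    field_simp
  · intro h
    have h' := h.mul hr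
    rw [mul_one] at h'
    refine h'.congr' ?_
    filter_upwards [eventually_gt_atTop 0] with t ht
    have h1 : (t : ℝ) ≠ 0 := by positivity
    have h2 : ((t + a : ℕ) : ℝ) ≠ 0 := by positivity
    rw [div_pow]
    field_simp

/-! ### Upper bound for the number of classes by lattice points -/

section Sandwich

variable {σ : Type} [Fintype σ] [DecidableEq σ] {m : ℕ}

theorem castVec_map (φ : (σ → ℤ) →ₗ[ℤ] (Fin m → ℤ)) (x : σ → ℤ) :
    castVec (φ x) = ∑ i, (x i : ℝ) • castVec (φ (Pi.single i 1)) := by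
  conv_lhs => rw [← Finset.univ_sum_single x, map_sum, map_sum]
  refine Finset.sum_congr rfl fun i _ => ?_
  rw [show Pi.single i (x i) = x i • (Pi.single i 1 : σ → ℤ) by
    rw [← Pi.single_smul, smul_eq_mul, mul_one], map_smul, map_smul, Int.cast_smul_eq_zsmul]

omit [DecidableEq σ] in
theorem coordSum_natCast (x : σ → ℕ) : coordSum σ (fun i => (x i : ℤ)) = ((∑ i, x i : ℕ) : ℤ) := by
  rw [coordSum_apply]
  push_cast
  rfl

/-- The homomorphism induced on `ℤ^σ / Λ` by `φ` and the degree. -/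
def gradedMap (φ : (σ → ℤ) →ₗ[ℤ] (Fin m → ℤ)) (Λ : Submodule ℤ (σ → ℤ))
    (hΛ : Λ ≤ LinearMap.ker (φ.prod (coordSum σ))) : ((σ → ℤ) ⧸ Λ) →ₗ[ℤ] (Fin m → ℤ) × ℤ :=
  Λ.liftQ _ hΛ

variable (φ : (σ → ℤ) →ₗ[ℤ] (Fin m → ℤ)) (Λ : Submodule ℤ (σ → ℤ))
    (hΛ : Λ ≤ LinearMap.ker (φ.prod (coordSum σ))) (c : ℕ)

/-- A class paired with some `j < c` is sent to its value under `φ`, translated by `j φ(e_{i₀})` and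
by a constant. Degrees on `ker φ` are multiples of `c`, so among classes of one degree the image
determines `j`, and then the class up to the kernel of `gradedMap`. -/
theorem classCount_mul_le (i₀ : σ) [Finite (LinearMap.ker (gradedMap φ Λ hΛ))]
    (hc : 0 < c) (hdvd : ∀ x, φ x = 0 → (c : ℤ) ∣ coordSum σ x)
    (hex : ∃ x, φ x = 0 ∧ coordSum σ x = c) :
    ∃ a, ∀ t, classCount Λ t * c ≤ Nat.card (LinearMap.ker (gradedMap φ Λ hΛ)) *
      (dilatePoints (fun i => φ (Pi.single i 1)) (t + a)).ncard := by
  classical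
  obtain ⟨x₀, hx₀, hx₀c⟩ := hex
  let N : ℕ := ∑ i, (x₀ i).natAbs
  have hN : ∀ i, |(x₀ i : ℝ)| ≤ N := fun i => by
    have h : (x₀ i).natAbs ≤ N :=
      Finset.single_le_sum (f := fun i => (x₀ i).natAbs) (fun _ _ => Nat.zero_le _)
        (Finset.mem_univ i)
    rw [← Int.cast_abs, Int.abs_eq_natAbs]
    exact_mod_cast h
  refine ⟨N * Fintype.card σ, fun t => ?_⟩
  set D := dilatePoints (fun i => φ (Pi.single i 1)) (t + N * Fintype.card σ) with hD
  have hDfin : D.Finite := finite_dilatePoints _ _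
  have hTfin : (LinearMap.ker (gradedMap φ Λ hΛ) : Set ((σ → ℤ) ⧸ Λ)).Finite := Set.toFinite _
  have hCfin := finite_classSet Λ t
  let F : ((σ → ℤ) ⧸ Λ) × ℕ → (Fin m → ℤ) := fun g =>
    (gradedMap φ Λ hΛ g.1).1 + (g.2 : ℤ) • φ (Pi.single i₀ 1) + (N : ℤ) • φ (fun _ => 1)
  have hF : ∀ (x : σ → ℤ) (j : ℕ), F (Submodule.Quotient.mk x, j) =
      φ (x + (j : ℤ) • Pi.single i₀ 1 + (N : ℤ) • fun _ => 1) := by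
    intro x j
    rw [map_add, map_add, map_smul, map_smul]
    rfl
  have hcard := Finset.card_le_mul_card_image_of_maps_to
    (s := hCfin.toFinset ×ˢ Finset.range c) (t := hDfin.toFinset) (f := F) ?_
    (Nat.card (LinearMap.ker (gradedMap φ Λ hΛ))) ?_
  · rw [Finset.card_product, Finset.card_range] at hcard
    rwa [classCount, Set.ncard_eq_toFinset_card _ hCfin, Set.ncard_eq_toFinset_card _ hDfin]
  · rintro ⟨_, j⟩ hg
    simp only [Finset.mem_product, Set.Finite.mem_toFinset, Finset.mem_range] at hg
    obtain ⟨⟨x, hx, rfl⟩, hj⟩ := hg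
    rw [Set.Finite.mem_toFinset, natClass, hF]
    have hx₀' : castVec (φ x₀) = 0 := by rw [hx₀, map_zero]
    have hc' : (c : ℝ) ≠ 0 := by positivity
    rw [castVec_map] at hx₀'
    -- The obvious weights have total degree too large by `j`. Subtracting `j/c` times `x₀`, which
    -- `φ` kills and which has degree `c`, corrects this. Since `j/c ≤ 1` and `N` bounds every `|x₀
    -- i|`, the weights stay nonnegative.
    refine ⟨fun i => (x i : ℝ) + j * ((Pi.single i₀ 1 : σ → ℤ) i : ℝ) + N - j / c * x₀ i,
      fun i => ?_, ?_, ?_⟩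
    · have h1 : (0 : ℝ) ≤ ((Pi.single i₀ 1 : σ → ℤ) i : ℝ) := by
        by_cases h : i = i₀
        · subst h; simp
        · simp [Pi.single_eq_of_ne h]
      have h2 : (j : ℝ) / c ≤ 1 := by
        rw [div_le_one (by positivity)]
        exact_mod_cast hj.le
      have h3 : (j : ℝ) / c * x₀ i ≤ N :=
        calc (j : ℝ) / c * x₀ i ≤ j / c * |(x₀ i : ℝ)| :=
              mul_le_mul_of_nonneg_left (le_abs_self _) (by positivity)
          _ ≤ 1 * |(x₀ i : ℝ)| := mul_le_mul_of_nonneg_right h2 (abs_nonneg _)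
          _ ≤ N := by rw [one_mul]; exact hN i
      have h4 : (0 : ℝ) ≤ (x i : ℝ) + j * ((Pi.single i₀ 1 : σ → ℤ) i : ℝ) := by positivity
      linarith
    · rw [Finset.sum_sub_distrib, Finset.sum_add_distrib, Finset.sum_add_distrib,
        ← Finset.mul_sum, ← Finset.mul_sum, ← Int.cast_sum, ← Int.cast_sum,
        ← coordSum_apply x₀, hx₀c]
      have hx' : ∑ i, (x i : ℝ) = t := by exact_mod_cast hx
      rw [hx']
      simp only [Finset.sum_pi_single', Finset.mem_univ, if_true, Finset.sum_const, Finset.card_univ,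
        nsmul_eq_mul]
      push_cast
      field_simp
      ring
    · rw [castVec_map]
      have : ∀ i, ((x i : ℝ) + j * ((Pi.single i₀ 1 : σ → ℤ) i : ℝ) + N - j / c * x₀ i) •
          castVec (φ (Pi.single i 1)) =
          (((fun i => (x i : ℤ)) + (j : ℤ) • Pi.single i₀ 1 + (N : ℤ) • fun _ => 1 : σ → ℤ) i : ℝ) •
            castVec (φ (Pi.single i 1)) -
          ((j : ℝ) / c) • (x₀ i : ℝ) • castVec (φ (Pi.single i 1)) := by
        intro i
        rw [smul_smul, ← sub_smul]
        congr 1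
        simp
      rw [Finset.sum_congr rfl fun i _ => this i, Finset.sum_sub_distrib, ← Finset.smul_sum, hx₀',
        smul_zero, sub_zero]
  · intro y hy
    by_cases hne : ((hCfin.toFinset ×ˢ Finset.range c).filter fun g => F g = y).Nonempty
    swap
    · rw [Finset.not_nonempty_iff_eq_empty.1 hne]; simp
    obtain ⟨⟨g, j⟩, hg⟩ := hne
    simp only [Finset.mem_filter, Finset.mem_product, Set.Finite.mem_toFinset,
      Finset.mem_range] at hg
    obtain ⟨⟨⟨x, hx, rfl⟩, hj⟩, hxy⟩ := hg
    have hsub : ((hCfin.toFinset ×ˢ Finset.range c).filter fun g => F g = y) ⊆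
        hTfin.toFinset.image fun τ => (natClass Λ x + τ, j) := by
      rintro ⟨_, j'⟩ hg'
      simp only [Finset.mem_filter, Finset.mem_product, Set.Finite.mem_toFinset,
        Finset.mem_range] at hg'
      obtain ⟨⟨⟨x', hx', rfl⟩, hj'⟩, hxy'⟩ := hg'
      have h1 : φ ((fun i => (x' i : ℤ)) - (fun i => (x i : ℤ)) +
          ((j' : ℤ) - j) • Pi.single i₀ 1) = 0 := by
        have h2 := hxy'.trans hxy.symm
        rw [natClass, natClass, hF, hF, ← sub_eq_zero, ← map_sub] at h2
        rw [← h2, sub_smul]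
        congr 1
        abel
      have h2 : coordSum σ ((fun i => (x' i : ℤ)) - (fun i => (x i : ℤ)) +
          ((j' : ℤ) - j) • Pi.single i₀ 1) = j' - j := by
        have h3 : coordSum σ (Pi.single i₀ 1) = 1 := by rw [coordSum_apply]; simp
        rw [map_add, map_sub, map_smul, coordSum_natCast, coordSum_natCast, hx, hx', h3]
        simp
      have h3 := hdvd _ h1
      rw [h2] at h3
      -- Both lie in `[0, c)` and their difference is a multiple of `c`.
      have hjj : j' = j := by
        have := Int.eq_zero_of_abs_lt_dvd h3 (abs_lt.2 ⟨by omega, by omega⟩)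
        omega
      subst hjj
      rw [sub_self, zero_smul, add_zero] at h1 h2
      refine Finset.mem_image.2 ⟨natClass Λ x' - natClass Λ x, ?_, by simp⟩
      rw [Set.Finite.mem_toFinset, SetLike.mem_coe, LinearMap.mem_ker]
      exact Prod.ext h1 h2
    refine (Finset.card_le_card hsub).trans (Finset.card_image_le.trans ?_)
    rw [← Set.ncard_eq_toFinset_card _ hTfin, ← Nat.card_coe_set_eq]
    rfl

end Sandwich

/-! ### Lower bound: lifting lattice points to monomials -/

section Sandwich

variable {σ : Type} [Fintype σ] [DecidableEq σ] {m : ℕ}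
variable (φ : (σ → ℤ) →ₗ[ℤ] (Fin m → ℤ)) (Λ : Submodule ℤ (σ → ℤ))
    (hΛ : Λ ≤ LinearMap.ker (φ.prod (coordSum σ))) (c : ℕ)

/-- The elements of `ℤ^σ / Λ` lying, up to a translation, over the half-open unit parallelotope of
the weights. -/
def boxSet (i₀ : σ) : Set ((σ → ℤ) ⧸ Λ) :=
  {g | ∃ j < c, ∃ w : σ → ℝ, (∀ i, 0 ≤ w i) ∧ (∀ i, w i ≤ 1) ∧
    ((gradedMap φ Λ hΛ g).2 : ℝ) = ∑ i, w i ∧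
    castVec ((gradedMap φ Λ hΛ g).1 + (j : ℤ) • φ (Pi.single i₀ 1)) =
      ∑ i, w i • castVec (φ (Pi.single i 1))}

theorem finite_boxSet (i₀ : σ) [Finite (LinearMap.ker (gradedMap φ Λ hΛ))] :
    (boxSet φ Λ hΛ c i₀).Finite := by
  refine Set.Finite.of_finite_fibers (gradedMap φ Λ hΛ) ?_ ?_
  · have h1 : {y : Fin m → ℤ | ∀ k, |y k| ≤ ∑ i, |φ (Pi.single i 1) k| +
        c * |φ (Pi.single i₀ 1) k|}.Finite := finite_of_abs_le _ fun y hy => hy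
    refine (h1.prod (Set.finite_Icc (0 : ℤ) (Fintype.card σ))).subset ?_
    rintro _ ⟨g, ⟨j, hj, w, h0, hw, hs, hg⟩, rfl⟩
    refine ⟨fun k => ?_, ?_, ?_⟩
    · have h := abs_sum_smul_le (fun i => φ (Pi.single i 1)) w 1 h0 (by simpa using hw) k
      rw [← hg, castVec_apply] at h
      have h' : |((gradedMap φ Λ hΛ g).1 + (j : ℤ) • φ (Pi.single i₀ 1)) k| ≤
          ((1 : ℕ) : ℤ) * ∑ i, |φ (Pi.single i 1) k| := by exact_mod_cast h
      rw [Nat.cast_one, one_mul, Pi.add_apply, Pi.smul_apply, smul_eq_mul] at h'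
      have h2 : |(j : ℤ) * φ (Pi.single i₀ 1) k| ≤ c * |φ (Pi.single i₀ 1) k| := by
        rw [abs_mul, Nat.abs_cast]
        exact mul_le_mul_of_nonneg_right (by exact_mod_cast hj.le) (abs_nonneg _)
      calc |(gradedMap φ Λ hΛ g).1 k|
          = |((gradedMap φ Λ hΛ g).1 k + j * φ (Pi.single i₀ 1) k) -
              j * φ (Pi.single i₀ 1) k| := by rw [add_sub_cancel_right]
        _ ≤ _ := (abs_sub _ _).trans (add_le_add h' h2)
    · have : (0 : ℝ) ≤ ((gradedMap φ Λ hΛ g).2 : ℝ) := hs ▸ Finset.sum_nonneg fun i _ => h0 i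
      exact_mod_cast this
    · have : ((gradedMap φ Λ hΛ g).2 : ℝ) ≤ ∑ i : σ, 1 := hs ▸ Finset.sum_le_sum fun i _ => hw i
      rw [Finset.sum_const, Finset.card_univ, nsmul_eq_mul, mul_one] at this
      exact_mod_cast this
  · rintro _ ⟨g, -, rfl⟩
    have hT : (LinearMap.ker (gradedMap φ Λ hΛ) : Set ((σ → ℤ) ⧸ Λ)).Finite := Set.toFinite _
    refine (hT.image (g + ·)).subset ?_
    rintro g' ⟨-, hg'⟩
    refine ⟨g' - g, ?_, by simp⟩
    rw [SetLike.mem_coe, LinearMap.mem_ker, map_sub, sub_eq_zero]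
    exact hg'

/-- Every class over the cone of the weights, translated by a fixed multiple of the all-ones
vector, is the class of a monomial. -/
theorem exists_conductor (i₀ : σ) [Finite (LinearMap.ker (gradedMap φ Λ hΛ))] :
    ∃ N : ℕ, ∀ (t j : ℕ) (g : (σ → ℤ) ⧸ Λ), j < c → (gradedMap φ Λ hΛ g).2 = t →
      (gradedMap φ Λ hΛ g).1 + (j : ℤ) • φ (Pi.single i₀ 1) ∈
        dilatePoints (fun i => φ (Pi.single i 1)) t →
      g + natClass Λ (fun _ => N) ∈ classSet Λ (t + N * Fintype.card σ) := by
  choose Z hZ using fun g : (σ → ℤ) ⧸ Λ => Submodule.Quotient.mk_surjective Λ g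
  have hfin := finite_boxSet φ Λ hΛ c i₀
  refine ⟨∑ f ∈ hfin.toFinset, ∑ i, (Z f i).natAbs, fun t j g hj hgt hg => ?_⟩
  set N := ∑ f ∈ hfin.toFinset, ∑ i, (Z f i).natAbs
  have hN : ∀ f ∈ boxSet φ Λ hΛ c i₀, ∀ i, 0 ≤ Z f i + N := by
    intro f hf i
    have h1 : (Z f i).natAbs ≤ ∑ i, (Z f i).natAbs :=
      Finset.single_le_sum (f := fun i => (Z f i).natAbs) (fun _ _ => Nat.zero_le _)
        (Finset.mem_univ i)
    have h2 : ∑ i, (Z f i).natAbs ≤ N :=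
      Finset.single_le_sum (f := fun f => ∑ i, (Z f i).natAbs) (fun _ _ => Nat.zero_le _)
        (hfin.mem_toFinset.2 hf)
    omega
  obtain ⟨w, h0, hwt, hwg⟩ := hg
  -- Removing the integer parts of the weights leaves an element of the finite set `boxSet`. The
  -- constant `N` outweighs the negative coordinates of the chosen lifts of that set, so adding `N`
  -- everywhere yields a genuine exponent vector.
  let n : σ → ℕ := fun i => ⌊w i⌋₊
  let f := g - natClass Λ n
  have hgn : gradedMap φ Λ hΛ (natClass Λ n) = (φ fun i => (n i : ℤ), ((∑ i, n i : ℕ) : ℤ)) :=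
    Prod.ext rfl (coordSum_natCast n)
  have hf : f ∈ boxSet φ Λ hΛ c i₀ := by
    refine ⟨j, hj, fun i => w i - n i, fun i => sub_nonneg.2 (Nat.floor_le (h0 i)),
      fun i => by linarith [Nat.lt_floor_add_one (w i)], ?_, ?_⟩
    · rw [map_sub, Prod.snd_sub, hgt, hgn, Finset.sum_sub_distrib, hwt]
      push_cast
      rfl
    · rw [map_sub, Prod.fst_sub, hgn, sub_add_eq_add_sub, map_sub, ← hwg, castVec_map]
      simp only [sub_smul, Finset.sum_sub_distrib]
      rfl
  have hx : ∀ i, (((n i + Z f i + N).toNat : ℕ) : ℤ) = n i + Z f i + N := fun i => by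
    have := hN f hf i
    omega
  have hclass : natClass Λ (fun i => (n i + Z f i + N).toNat) = g + natClass Λ fun _ => N := by
    have h1 : natClass Λ (fun i => (n i + Z f i + N).toNat) =
        natClass Λ n + Submodule.Quotient.mk (Z f) + natClass Λ fun _ => N := by
      unfold natClass
      rw [← Submodule.Quotient.mk_add, ← Submodule.Quotient.mk_add]
      congr 1
      funext i
      exact hx i
    rw [h1, hZ]
    simp only [f]
    abel
  refine ⟨fun i => (n i + Z f i + N).toNat, ?_, hclass⟩
  have h1 : (gradedMap φ Λ hΛ (natClass Λ fun i => (n i + Z f i + N).toNat)).2 =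
      (gradedMap φ Λ hΛ (g + natClass Λ fun _ => N)).2 := by rw [hclass]
  rw [map_add, Prod.snd_add, hgt] at h1
  change coordSum σ _ = t + coordSum σ (fun _ => ((N : ℕ) : ℤ)) at h1
  rw [coordSum_natCast, coordSum_natCast (fun _ => N)] at h1
  rw [Set.mem_ofPred_eq]
  rw [Finset.sum_const, Finset.card_univ, smul_eq_mul, mul_comm] at h1
  exact_mod_cast h1

theorem le_classCount_mul (i₀ : σ) (hφ : Function.Surjective φ)
    [Finite (LinearMap.ker (gradedMap φ Λ hΛ))]
    (hc : 0 < c) (hex : ∃ x, φ x = 0 ∧ coordSum σ x = c) :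
    ∃ a, ∀ t, Nat.card (LinearMap.ker (gradedMap φ Λ hΛ)) *
      (dilatePoints (fun i => φ (Pi.single i 1)) t).ncard ≤ classCount Λ (t + a) * c := by
  classical
  obtain ⟨N, hN⟩ := exists_conductor φ Λ hΛ c i₀
  obtain ⟨x₀, hx₀, hx₀c⟩ := hex
  refine ⟨N * Fintype.card σ, fun t => ?_⟩
  -- A lift of `y` has some degree, which is corrected to `t` by division with remainder by `c`. The
  -- quotient is absorbed by `x₀ ∈ ker φ`; the remainder `j` costs a translation by `j φ(e_{i₀})`.
  have hrep : ∀ y : Fin m → ℤ, ∃ (g : (σ → ℤ) ⧸ Λ) (j : ℕ), j < c ∧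
      gradedMap φ Λ hΛ g = (y - (j : ℤ) • φ (Pi.single i₀ 1), (t : ℤ)) := by
    intro y
    obtain ⟨x, rfl⟩ := hφ y
    have hc' : (c : ℤ) ≠ 0 := by exact_mod_cast hc.ne'
    have h0 := Int.emod_nonneg (coordSum σ x - t) hc'
    have h1 := Int.emod_lt_of_pos (coordSum σ x - t) (show (0 : ℤ) < c by exact_mod_cast hc)
    have h2 := Int.emod_add_mul_ediv (coordSum σ x - t) c
    obtain ⟨j, hj⟩ := Int.eq_ofNat_of_zero_le h0
    rw [hj] at h1 h2
    refine ⟨Submodule.Quotient.mk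
      (x - (j : ℤ) • Pi.single i₀ 1 - ((coordSum σ x - t) / c) • x₀), j, by exact_mod_cast h1, ?_⟩
    refine Prod.ext ?_ ?_
    · change φ _ = _
      rw [map_sub, map_sub, map_smul, map_smul, hx₀, smul_zero, sub_zero]
    · change coordSum σ _ = _
      rw [map_sub, map_sub, map_smul, map_smul, hx₀c, coordSum_apply (Pi.single i₀ 1)]
      simp only [Finset.sum_pi_single', Finset.mem_univ, if_true, smul_eq_mul, mul_one]
      linarith
  choose g j hj hg using hrep
  have hT : (LinearMap.ker (gradedMap φ Λ hΛ) : Set ((σ → ℤ) ⧸ Λ)).Finite := Set.toFinite _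
  have hD := finite_dilatePoints (fun i => φ (Pi.single i 1)) t
  have hC := finite_classSet Λ (t + N * Fintype.card σ)
  have hcard := Finset.card_le_card_of_injOn (s := hT.toFinset ×ˢ hD.toFinset)
    (t := hC.toFinset ×ˢ Finset.range c)
    (fun τ => (g τ.2 + τ.1 + natClass Λ (fun _ => N), j τ.2)) ?_ ?_
  · rw [Finset.card_product, Finset.card_product, Finset.card_range,
      ← Set.ncard_eq_toFinset_card _ hT, ← Set.ncard_eq_toFinset_card _ hD,
      ← Set.ncard_eq_toFinset_card _ hC, ← Nat.card_coe_set_eq] at hcard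
    exact hcard
  · rintro ⟨τ, y⟩ hτ
    simp only [Finset.coe_product, Set.Finite.coe_toFinset, Set.mem_prod, SetLike.mem_coe,
      LinearMap.mem_ker] at hτ
    simp only [Finset.coe_product, Set.Finite.coe_toFinset, Set.mem_prod, Finset.coe_range,
      Set.mem_Iio]
    have h : gradedMap φ Λ hΛ (g y + τ) = (y - (j y : ℤ) • φ (Pi.single i₀ 1), (t : ℤ)) := by
      rw [map_add, hτ.1, add_zero, hg]
    refine ⟨hN t (j y) _ (hj y) (by rw [h]) ?_, hj y⟩
    rw [h, sub_add_cancel]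
    exact hτ.2
  · rintro ⟨τ, y⟩ hτ ⟨τ', y'⟩ hτ' h
    simp only [Finset.coe_product, Set.Finite.coe_toFinset, Set.mem_prod, SetLike.mem_coe,
      LinearMap.mem_ker] at hτ hτ'
    simp only [Prod.mk.injEq, add_left_inj] at h
    obtain ⟨h1, h2⟩ := h
    have h3 := congrArg (fun x => (gradedMap φ Λ hΛ x).1) h1
    simp only [map_add, hτ.1, hτ'.1, add_zero, hg, h2, sub_left_inj] at h3
    subst h3
    rw [add_right_inj] at h1
    rw [h1]

/-- The number of classes of monomials of degree `t` modulo a lattice `Λ` is asymptotically given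
by the volume of the convex hull of the images of the unit vectors under a surjection
`φ : ℤ^σ → ℤ^m` such that `Λ` has finite index in the vectors of degree zero in its kernel. -/
theorem tendsto_classCount [Nonempty σ] (hφ : Function.Surjective φ)
    [Finite (LinearMap.ker (gradedMap φ Λ hΛ))]
    (hc : 0 < c) (hdvd : ∀ x, φ x = 0 → (c : ℤ) ∣ coordSum σ x)
    (hex : ∃ x, φ x = 0 ∧ coordSum σ x = c) :
    Tendsto (fun t : ℕ => (classCount Λ t : ℝ) * c / (t : ℝ) ^ m) atTop
      (𝓝 (Nat.card (LinearMap.ker (gradedMap φ Λ hΛ)) * (MeasureTheory.volume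
        (convexHull ℝ (Set.range fun i => castVec (φ (Pi.single i 1))))).toReal)) := by
  obtain ⟨i₀⟩ := ‹Nonempty σ›
  obtain ⟨a, ha⟩ := classCount_mul_le φ Λ hΛ c i₀ hc hdvd hex
  obtain ⟨b, hb⟩ := le_classCount_mul φ Λ hΛ c i₀ hφ hc hex
  have hlim := (tendsto_ncard_dilatePoints fun i => φ (Pi.single i 1)).const_mul
    (Nat.card (LinearMap.ker (gradedMap φ Λ hΛ)) : ℝ)
  simp only [← mul_div_assoc] at hlim
  -- The class count at `t + b` lies between the point counts of the dilates by `t` and by `t + b +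
  -- a`.
  rw [← tendsto_div_pow_shift (f := fun t => (classCount Λ t : ℝ) * c) b]
  refine tendsto_of_tendsto_of_tendsto_of_le_of_le hlim
    ((tendsto_div_pow_shift (f := fun t => (Nat.card (LinearMap.ker (gradedMap φ Λ hΛ)) : ℝ) *
      (dilatePoints (fun i => φ (Pi.single i 1)) t).ncard) (b + a)).2 hlim) ?_ ?_
  · intro t
    exact div_le_div_of_nonneg_right (by exact_mod_cast hb t) (by positivity)
  · intro t
    refine div_le_div_of_nonneg_right ?_ (by positivity)
    rw [← add_assoc]
    exact_mod_cast ha (t + b)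

end Sandwich

/-! ### Degrees from the growth of the Hilbert function -/

/-- Since `V ≠ 0`, the Hilbert polynomial has degree exactly `m`: a smaller degree would give limit
zero and a larger one divergence. Its leading coefficient is then `V`. -/
theorem degree_eq_of_tendsto {σ : Type} [Fintype σ] (I : Ideal (MvPolynomial σ ℂ))
    (hI : EventuallyPolynomial fun t => hilbertFunction I t) (m : ℕ) (V : ℝ) (hV : V ≠ 0)
    (h : Tendsto (fun t : ℕ => (hilbertFunction I t : ℝ) / (t : ℝ) ^ m) atTop (𝓝 V)) :
    (degree I : ℝ) = m.factorial * V := by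
  have hp : IsHilbertPolynomial I (hilbertPolynomial I) := by
    have hex : ∃ p, IsHilbertPolynomial I p := hI
    rw [hilbertPolynomial, dif_pos hex]
    exact hex.choose_spec
  set p := hilbertPolynomial I with hpdef
  let q : Polynomial ℝ := p.map (algebraMap ℚ ℝ)
  have hq : ∀ᶠ t : ℕ in atTop, q.eval (t : ℝ) = hilbertFunction I t := by
    filter_upwards [hp] with t ht
    have h1 : q.eval ((algebraMap ℚ ℝ) (t : ℚ)) = algebraMap ℚ ℝ (p.eval (t : ℚ)) :=
      Polynomial.eval_map_apply (algebraMap ℚ ℝ) _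
    rw [ht] at h1
    simpa using h1
  have hqlim : Tendsto (fun t : ℕ => q.eval (t : ℝ) / (Polynomial.X ^ m : Polynomial ℝ).eval (t : ℝ))
      atTop (𝓝 V) := by
    refine h.congr' ?_
    filter_upwards [hq] with t ht
    rw [ht]
    simp
  have hX : (Polynomial.X ^ m : Polynomial ℝ) ≠ 0 := pow_ne_zero _ Polynomial.X_ne_zero
  have hcast := tendsto_natCast_atTop_atTop (R := ℝ)
  have hdeg : q.degree = (Polynomial.X ^ m : Polynomial ℝ).degree := by
    rcases lt_trichotomy q.degree (Polynomial.X ^ m : Polynomial ℝ).degree with hlt | heq | hgt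
    · exact absurd (tendsto_nhds_unique hqlim
        ((Polynomial.div_tendsto_atTop_zero_of_degree_lt q _ hlt).comp hcast)) hV
    · exact heq
    · exact absurd ((Polynomial.abs_div_tendsto_atTop_atTop_of_degree_gt q _ hgt hX).comp hcast)
        (not_tendsto_atTop_of_tendsto_nhds hqlim.abs)
  have hlead := tendsto_nhds_unique hqlim
    ((Polynomial.div_tendsto_atTop_leadingCoeff_div_of_degree_eq q _ hdeg).comp hcast)
  rw [Polynomial.leadingCoeff_X_pow, div_one] at hlead
  have hdeg' : p.degree = m := by
    rwa [Polynomial.degree_X_pow, Polynomial.degree_map] at hdeg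
  have hp0 : p ≠ 0 := by
    rintro h0
    rw [h0, Polynomial.degree_zero] at hdeg'
    exact absurd hdeg' (by simp)
  rw [degree, ← hpdef, if_neg hp0, Polynomial.natDegree_eq_of_degree_eq_some hdeg', hlead]
  simp [q]

/-! ### Lattices of rank one -/

section RankOne

variable {σ : Type} [Fintype σ]

theorem ncard_sum_eq (k : ℕ) (hσ : Fintype.card σ = k + 2) (t : ℕ) :
    {x : σ → ℕ | ∑ i, x i = t}.ncard = (t + k + 1).choose (k + 1) := by
  classical
  have h := Finset.card_finsuppAntidiag_nat_eq_choose (s := (Finset.univ : Finset σ)) t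
  rw [Finset.card_univ, hσ, ← Set.ncard_coe_finset] at h
  rw [← Nat.choose_symm_of_eq_add (show t + k + 1 = t + (k + 1) by ring),
    show t + k + 1 = k + 2 + t - 1 by omega, ← h]
  refine Set.ncard_congr (fun x _ => Finsupp.equivFunOnFinite.symm x) ?_ ?_ ?_
  · intro x hx
    simpa [Finset.mem_finsuppAntidiag] using hx
  · intro x y _ _ hxy
    exact Finsupp.equivFunOnFinite.symm.injective hxy
  · intro f hf
    refine ⟨f, ?_, Finsupp.equivFunOnFinite.symm_apply_apply f⟩
    simpa [Finset.mem_finsuppAntidiag] using hf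

/-- This is the Hilbert function of a hypersurface: the monomials not divisible by `x^(v⁺)`
represent each class exactly once, and the divisible ones are `x^(v⁺)` times an arbitrary monomial
of degree `t`. -/
theorem classCount_span_singleton_add (v : σ → ℤ) (hv : v ≠ 0) (hsum : ∑ i, v i = 0) (t : ℕ) :
    classCount (Submodule.span ℤ {v}) (t + ∑ i, (v i).toNat) +
      {x : σ → ℕ | ∑ i, x i = t}.ncard =
      {x : σ → ℕ | ∑ i, x i = t + ∑ i, (v i).toNat}.ncard := by
  classical
  set D := ∑ i, (v i).toNat with hD
  obtain ⟨i₁, hi₁⟩ : ∃ i, 0 < v i := by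
    by_contra! hle
    refine hv (funext fun i => ?_)
    exact (Finset.sum_eq_zero_iff_of_nonpos fun i _ => hle i).1 hsum i (Finset.mem_univ i)
  let S : Set (σ → ℕ) := {x | ∑ i, x i = t + D}
  let U : Set (σ → ℕ) := {x | ∀ i, (v i).toNat ≤ x i}
  have hS : S.Finite := finite_sum_eq _
  have h1 : {x : σ → ℕ | ∑ i, x i = t}.ncard = (S ∩ U).ncard := by
    refine Set.ncard_congr (fun x _ i => x i + (v i).toNat) ?_ ?_ ?_
    · intro x hx
      refine ⟨?_, fun i => Nat.le_add_left _ _⟩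
      rw [Set.mem_ofPred_eq] at hx ⊢
      rw [Finset.sum_add_distrib, hx]
    · intro x y _ _ hxy
      funext i
      exact Nat.add_right_cancel (congrFun hxy i)
    · rintro x ⟨hx, hxU⟩
      have h : ∀ i, x i - (v i).toNat + (v i).toNat = x i := fun i => Nat.sub_add_cancel (hxU i)
      refine ⟨fun i => x i - (v i).toNat, ?_, funext h⟩
      have h2 : ∑ i, (x i - (v i).toNat + (v i).toNat) = t + D := by
        rw [Finset.sum_congr rfl fun i _ => h i]; exact hx
      rw [Finset.sum_add_distrib] at h2
      exact Nat.add_right_cancel h2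
  have hclass : ∀ x y : σ → ℕ, natClass (Submodule.span ℤ {v}) x = natClass _ y ↔
      ∃ a : ℤ, ∀ i, (x i : ℤ) = y i + a * v i := by
    intro x y
    rw [natClass_eq_iff, Submodule.mem_span_singleton]
    refine exists_congr fun a => ?_
    rw [funext_iff]
    refine forall_congr' fun i => ?_
    rw [Pi.smul_apply, smul_eq_mul]
    omega
  have h2 : (S \ U).ncard = classCount (Submodule.span ℤ {v}) (t + D) := by
    refine Set.ncard_congr (fun x _ => natClass _ x) ?_ ?_ ?_
    · intro x hx
      exact ⟨x, hx.1, rfl⟩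
    · intro x y hx hy hxy
      -- If `x = y + a v` with `a ≥ 1`, then `x ≥ v⁺` because `y ≥ 0`. Applied in both directions,
      -- this forces `a = 0`.
      have key : ∀ x y : σ → ℕ, x ∉ U → ∀ a : ℤ, (∀ i, (x i : ℤ) = y i + a * v i) → a ≤ 0 := by
        intro x y hx a ha
        by_contra! ha0
        refine hx fun i => ?_
        have h3 := ha i
        rcases le_total (v i) 0 with hvi | hvi
        · rw [Int.toNat_of_nonpos hvi]; exact Nat.zero_le _
        · have h4 : v i ≤ a * v i := le_mul_of_one_le_left hvi ha0
          omega
      obtain ⟨a, ha⟩ := (hclass x y).1 hxy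
      have h3 := key x y hx.2 a ha
      have h4 := key y x hy.2 (-a) fun i => by rw [ha i]; ring
      have h5 : a = 0 := by omega
      funext i
      have := ha i
      rw [h5, zero_mul, add_zero] at this
      exact_mod_cast this
    · rintro _ ⟨x, hx, rfl⟩
      -- Descent: subtracting `v` from a vector above `v⁺` preserves degree and class and lowers the
      -- coordinate `i₁`.
      have key : ∀ n : ℕ, ∀ x : σ → ℕ, x i₁ = n → x ∈ S →
          ∃ y, y ∈ S \ U ∧ natClass (Submodule.span ℤ {v}) y = natClass _ x := by
        intro n
        induction n using Nat.strong_induction_on with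
        | _ n ih =>
          intro x hxn hxS
          by_cases hxU : x ∈ U
          · have hy : ∀ i, (((x i - v i).toNat : ℕ) : ℤ) = x i - v i := fun i => by
              have : (v i).toNat ≤ x i := hxU i
              omega
            have hy₁ := hy i₁
            obtain ⟨y, hyS, hyx⟩ := ih _ (by omega) (fun i => (x i - v i).toNat) rfl (by
              have h3 : ((∑ i, (x i - v i).toNat : ℕ) : ℤ) = ((∑ i, x i : ℕ) : ℤ) := by
                push_cast [hy]
                rw [Finset.sum_sub_distrib, hsum, sub_zero]
              exact (by exact_mod_cast h3 : ∑ i, (x i - v i).toNat = ∑ i, x i).trans hxS)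
            refine ⟨y, hyS, hyx.trans ((hclass _ _).2 ⟨-1, fun i => ?_⟩)⟩
            rw [hy]
            ring
          · exact ⟨x, ⟨hxS, hxU⟩, rfl⟩
      obtain ⟨y, hy, hyx⟩ := key _ x rfl hx
      exact ⟨y, hy, hyx⟩
  rw [h1, ← h2, add_comm]
  exact Set.ncard_inter_add_ncard_sdiff_eq_ncard S U hS

/-- The difference of the two binomial coefficients telescopes into `∑ v_i⁺` terms, each asymptotic
to `t^k / k!`. -/
theorem tendsto_classCount_span_singleton (v : σ → ℤ) (hv : v ≠ 0) (hsum : ∑ i, v i = 0) (k : ℕ)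
    (hσ : Fintype.card σ = k + 2) :
    Tendsto (fun t : ℕ => (classCount (Submodule.span ℤ {v}) t : ℝ) / (t : ℝ) ^ k) atTop
      (𝓝 (((∑ i, (v i).toNat : ℕ) : ℝ) / k.factorial)) := by
  set D := ∑ i, (v i).toNat with hD
  have hcount : ∀ t, classCount (Submodule.span ℤ {v}) (t + D) =
      ∑ j ∈ Finset.range D, (t + (j + 1 + k)).choose k := by
    intro t
    have h := classCount_span_singleton_add v hv hsum t
    rw [ncard_sum_eq k hσ, ncard_sum_eq k hσ] at h
    have hsumchoose : ∀ n, (t + n + k + 1).choose (k + 1) =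
        (∑ j ∈ Finset.range n, (t + (j + 1 + k)).choose k) + (t + k + 1).choose (k + 1) := by
      intro n
      induction n with
      | zero => simp
      | succ n ih =>
        rw [Finset.sum_range_succ, show t + (n + 1) + k + 1 = (t + n + k + 1) + 1 by ring,
          Nat.choose_succ_succ, ih, show t + (n + 1 + k) = t + n + k + 1 by ring]
        ring
    rw [← hD, hsumchoose] at h
    omega
  rw [← tendsto_div_pow_shift (f := fun t => (classCount (Submodule.span ℤ {v}) t : ℝ)) D]
  simp only [hcount]
  push_cast
  simp only [Finset.sum_div]
  have hone : Tendsto (fun t : ℕ => (t.choose k : ℝ) / (t : ℝ) ^ k) atTop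
      (𝓝 (1 / k.factorial)) := by
    have h := (isEquivalent_choose k).div (Asymptotics.IsEquivalent.refl
      (u := fun t : ℕ => (t : ℝ) ^ k))
    refine (h.symm.tendsto_nhds ?_)
    refine tendsto_const_nhds.congr' ?_
    filter_upwards [eventually_gt_atTop 0] with t ht
    have : (t : ℝ) ≠ 0 := by positivity
    simp only [Pi.div_apply]
    field_simp
  have h := tendsto_finsetSum (Finset.range D) fun j _ =>
    (tendsto_div_pow_shift (f := fun t => (t.choose k : ℝ)) (j + 1 + k)).2 hone
  rw [Finset.sum_const, Finset.card_range, nsmul_eq_mul, mul_one_div] at h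
  exact h

end RankOne

/-! ### Lattices of rank two and their saturations -/

section RankTwo

variable {σ : Type}

theorem det2_eq (v w : Fin 2 → ℤ) : det2 v w = v 0 * w 1 - v 1 * w 0 := by
  rw [det2, Matrix.det_fin_two]
  rfl

/-- The columns of `B` are linearly independent. -/
def ColumnsIndependent (B : Matrix σ (Fin 2) ℤ) : Prop :=
  ∀ a b : ℤ, (∀ i, a * B i 0 + b * B i 1 = 0) → a = 0 ∧ b = 0

/-- `M` is the saturation of the lattice `Λ`. -/
def IsSaturationOf (M Λ : Submodule ℤ (σ → ℤ)) : Prop :=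
  ∀ x, x ∈ M ↔ ∃ N : ℤ, N ≠ 0 ∧ N • x ∈ Λ

theorem IsSaturationOf.le {M Λ : Submodule ℤ (σ → ℤ)} (h : IsSaturationOf M Λ) : Λ ≤ M :=
  fun x hx => (h x).2 ⟨1, one_ne_zero, by rwa [one_smul]⟩

theorem IsSaturationOf.mem_of_smul_mem {M Λ : Submodule ℤ (σ → ℤ)} (h : IsSaturationOf M Λ)
    {p : ℤ} (hp : p ≠ 0) {x : σ → ℤ} (hx : p • x ∈ M) : x ∈ M := by
  obtain ⟨N, hN, hNx⟩ := (h _).1 hx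
  exact (h _).2 ⟨N * p, mul_ne_zero hN hp, by rwa [mul_smul]⟩

theorem linearIndependent_columns {B : Matrix σ (Fin 2) ℤ} (hB : ColumnsIndependent B) :
    LinearIndependent ℤ fun (k : Fin 2) (i : σ) => B i k := by
  rw [Fintype.linearIndependent_iff]
  intro a ha
  obtain ⟨h0, h1⟩ := hB (a 0) (a 1) fun i => by
    have h := congrFun ha i
    rw [Fin.sum_univ_two] at h
    exact h
  exact Fin.forall_fin_two.2 ⟨h0, h1⟩

variable [Fintype σ]

/-- A common denominator embeds `M` into the column lattice, which lies in `M`; hence both have rank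
two. -/
theorem exists_basis_of_saturation {B : Matrix σ (Fin 2) ℤ} (hB : ColumnsIndependent B)
    {M : Submodule ℤ (σ → ℤ)} (hM : IsSaturationOf M (columnLattice B)) :
    Nonempty (Module.Basis (Fin 2) ℤ M) := by
  have hrank : Module.finrank ℤ (columnLattice B) = 2 := by
    rw [columnLattice, finrank_span_eq_card (linearIndependent_columns hB), Fintype.card_fin]
  let b := Module.finBasis ℤ M
  choose N hN hNb using fun i => (hM (b i : σ → ℤ)).1 (b i).2
  let P : ℤ := ∏ i, N i
  have hP : P ≠ 0 := Finset.prod_ne_zero_iff.2 fun i _ => hN i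
  have hmem : ∀ x : M, P • (x : σ → ℤ) ∈ columnLattice B := by
    intro x
    rw [← b.sum_repr x, Submodule.coe_sum, Finset.smul_sum]
    refine Submodule.sum_mem _ fun i _ => ?_
    obtain ⟨q, hq⟩ := Finset.dvd_prod_of_mem N (Finset.mem_univ i)
    rw [Submodule.coe_smul, smul_smul, show P * b.repr x i = (q * b.repr x i) * N i by
      simp only [P, hq]; ring, mul_smul]
    exact Submodule.smul_mem _ _ (hNb i)
  have hle : Module.finrank ℤ M ≤ 2 := by
    rw [← hrank]
    refine LinearMap.finrank_le_finrank_of_injective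
      (f := ((P • LinearMap.id).comp M.subtype).codRestrict (columnLattice B) hmem) ?_
    intro x y hxy
    have h := congrArg Subtype.val hxy
    exact Subtype.ext (smul_right_injective _ hP h)
  have hge : 2 ≤ Module.finrank ℤ M := by
    rw [← hrank]
    exact LinearMap.finrank_le_finrank_of_injective (Submodule.inclusion_injective hM.le)
  exact ⟨Module.finBasisOfFinrankEq ℤ M (le_antisymm hle hge)⟩

omit [Fintype σ] in
theorem basis_expansion {M : Submodule ℤ (σ → ℤ)} (b : Module.Basis (Fin 2) ℤ M) :
    ∀ y ∈ M, ∃ α β : ℤ, y = α • (b 0 : σ → ℤ) + β • (b 1 : σ → ℤ) := by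
  intro y hy
  have h := congrArg Subtype.val (b.sum_repr ⟨y, hy⟩)
  rw [Fin.sum_univ_two] at h
  exact ⟨_, _, h.symm⟩

omit [Fintype σ] in
theorem basis_expansion_unique {M : Submodule ℤ (σ → ℤ)} (b : Module.Basis (Fin 2) ℤ M) :
    ∀ α β α' β' : ℤ, α • (b 0 : σ → ℤ) + β • (b 1 : σ → ℤ) =
      α' • (b 0 : σ → ℤ) + β' • (b 1 : σ → ℤ) → α = α' ∧ β = β' := by
  intro α β α' β' h
  have h' : α • b 0 + β • b 1 = α' • b 0 + β' • b 1 := Subtype.ext h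
  have h0 := congrArg (fun z => b.repr z 0) h'
  have h1 := congrArg (fun z => b.repr z 1) h'
  simp at h0 h1
  exact ⟨h0, h1⟩

/-- If a prime `p` divided all minors, the basis would be dependent modulo `p`: some combination
with a coefficient prime to `p` would be divisible by `p`. Saturation then puts its quotient by `p`
in `M`, contradicting uniqueness of coordinates. -/
theorem gcd_minors_basis_eq_one {M Λ : Submodule ℤ (σ → ℤ)} (hM : IsSaturationOf M Λ)
    (b : Module.Basis (Fin 2) ℤ M) :
    (Finset.univ : Finset (σ × σ)).gcd (fun p => (b 0 : σ → ℤ) p.1 * (b 1 : σ → ℤ) p.2 -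
      (b 0 : σ → ℤ) p.2 * (b 1 : σ → ℤ) p.1) = 1 := by
  set f : σ × σ → ℤ := fun p => (b 0 : σ → ℤ) p.1 * (b 1 : σ → ℤ) p.2 -
      (b 0 : σ → ℤ) p.2 * (b 1 : σ → ℤ) p.1 with hf
  have hexp := basis_expansion b
  have huniq := basis_expansion_unique b
  have hdiv : ∀ (p : ℤ), p ≠ 0 → ∀ α β : ℤ,
      (∀ i, p ∣ α * (b 0 : σ → ℤ) i + β * (b 1 : σ → ℤ) i) → p ∣ α ∧ p ∣ β := by
    intro p hp α β h
    choose y hy using h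
    have hyp : p • y = α • (b 0 : σ → ℤ) + β • (b 1 : σ → ℤ) := funext fun i => (hy i).symm
    have hyM : y ∈ M := hM.mem_of_smul_mem hp (by
      rw [hyp]
      exact M.add_mem (M.smul_mem _ (b 0).2) (M.smul_mem _ (b 1).2))
    obtain ⟨α', β', rfl⟩ := hexp y hyM
    rw [smul_add, smul_smul, smul_smul] at hyp
    obtain ⟨h0, h1⟩ := huniq _ _ _ _ hyp
    exact ⟨⟨_, h0.symm⟩, ⟨_, h1.symm⟩⟩
  have habs : ((Finset.univ : Finset (σ × σ)).gcd f).natAbs = 1 := by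
    by_contra hne
    obtain ⟨p, hp, hpd⟩ := Nat.exists_prime_and_dvd hne
    have hall : ∀ q, (p : ℤ) ∣ f q := fun q =>
      (Int.natCast_dvd.2 hpd).trans (Finset.gcd_dvd (Finset.mem_univ q))
    have hp0 : (p : ℤ) ≠ 0 := by exact_mod_cast hp.ne_zero
    by_cases hv : ∀ i, (p : ℤ) ∣ (b 0 : σ → ℤ) i
    · have h := (hdiv p hp0 1 0 fun i => by simpa using hv i).1
      exact hp.one_lt.ne' (by exact_mod_cast Int.eq_one_of_dvd_one (by positivity) h)
    · push Not at hv
      obtain ⟨i, hi⟩ := hv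
      have h := (hdiv p hp0 (-(b 1 : σ → ℤ) i) ((b 0 : σ → ℤ) i) fun j => by
        have := hall (i, j)
        simp only [hf] at this
        convert this using 1
        ring).2
      exact hi h
  have hnorm : normalize ((Finset.univ : Finset (σ × σ)).gcd f) =
      (Finset.univ : Finset (σ × σ)).gcd f := Finset.normalize_gcd
  rw [← hnorm, ← Int.abs_eq_normalize, Int.abs_eq_natAbs, habs, Nat.cast_one]

/-- Let `E` express the columns of `B` in a basis `v₀, v₁` of `M`. All minors get multiplied by `det
E`, so index and gcd are both `|det E|`. If `s₀, s₁` are the coordinate sums of the basis and `c` is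
their gcd, the sum-zero part of `M` is generated by `(s₁ v₀ - s₀ v₁)/c`. Since `w = -E s`, expanding
`det(w, b_j)` gives the last formula, the sign of `det E` being absorbed into `v`. -/
theorem columnLattice_saturation {B : Matrix σ (Fin 2) ℤ} (hB : ColumnsIndependent B)
    {M : Submodule ℤ (σ → ℤ)} (hM : IsSaturationOf M (columnLattice B)) :
    ∃ g : ℕ, 0 < g ∧ (columnLattice B).toAddSubgroup.relIndex M.toAddSubgroup = g ∧
      (Finset.univ : Finset (σ × σ)).gcd (fun p => det2 (B p.1) (B p.2)) = g ∧
      ∀ w : Fin 2 → ℤ, w = -∑ i, B i → w ≠ 0 → ∃ (c : ℕ) (v : σ → ℤ), 0 < c ∧ v ≠ 0 ∧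
        v ∈ M ∧ ∑ i, v i = 0 ∧ (∀ x ∈ M, (c : ℤ) ∣ ∑ i, x i) ∧ (∃ x ∈ M, ∑ i, x i = c) ∧
        (∀ x ∈ M, ∑ i, x i = 0 → x ∈ Submodule.span ℤ {v}) ∧
        ∀ j, det2 w (B j) = g * c * v j := by
  obtain ⟨b⟩ := exists_basis_of_saturation hB hM
  have hexp := basis_expansion b
  have huniq := basis_expansion_unique b
  have hgcd := gcd_minors_basis_eq_one hM b
  have hmem₀ := (b 0).2
  have hmem₁ := (b 1).2
  set v₀ : σ → ℤ := (b 0 : σ → ℤ) with hv₀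
  set v₁ : σ → ℤ := (b 1 : σ → ℤ) with hv₁
  have hli := linearIndependent_columns hB
  let bc : Module.Basis (Fin 2) ℤ (columnLattice B) := Module.Basis.span hli
  have hbc : ∀ k, (bc k : σ → ℤ) = fun i => B i k := fun k =>
    congrArg Subtype.val (Module.Basis.span_apply hli k)
  let E : Matrix (Fin 2) (Fin 2) ℤ := fun k l => b.repr ⟨bc k, hM.le (bc k).2⟩ l
  have hE : ∀ i k, B i k = E k 0 * v₀ i + E k 1 * v₁ i := by
    intro i k
    have h := congrArg Subtype.val (b.sum_repr ⟨bc k, hM.le (bc k).2⟩)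
    rw [Fin.sum_univ_two] at h
    have h' := congrFun (h.trans (hbc k)) i
    exact h'.symm
  have hdet : ∀ i j, det2 (B i) (B j) = E.det * (v₀ i * v₁ j - v₀ j * v₁ i) := by
    intro i j
    rw [det2_eq, Matrix.det_fin_two, hE, hE, hE, hE]
    ring
  have hindex : (columnLattice B).toAddSubgroup.relIndex M.toAddSubgroup = E.det.natAbs := by
    refine (AddSubgroup.relIndex_eq_natAbs_det (columnLattice B).toAddSubgroup M.toAddSubgroup hM.le
      (ι := Fin 2) bc b).trans ?_
    change (b.det fun k => ⟨bc k, hM.le (bc k).2⟩).natAbs = _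
    rw [Module.Basis.det_apply, ← Matrix.det_transpose]
    rfl
  have hdet0 : E.det ≠ 0 := by
    intro h0
    rw [Matrix.det_fin_two] at h0
    -- The adjugate of a singular `E` gives relations between the columns, which force the first row
    -- of `E`, hence the first column of `B`, to vanish.
    have h1 := hB (E 1 1) (-E 0 1) fun i => by
      rw [hE, hE]
      linear_combination v₀ i * h0
    have h2 := hB (E 1 0) (-E 0 0) fun i => by
      rw [hE, hE]
      linear_combination -v₁ i * h0
    have h3 := hB 1 0 fun i => by
      rw [hE, neg_eq_zero.1 h1.2, neg_eq_zero.1 h2.2]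
      ring
    exact one_ne_zero h3.1
  refine ⟨E.det.natAbs, Int.natAbs_pos.2 hdet0, hindex, ?_, ?_⟩
  · simp only [hdet]
    rw [Finset.gcd_mul_left, hgcd, mul_one, ← Int.abs_eq_normalize,
      Int.abs_eq_natAbs]
  · intro w hw hw0
    set s₀ := ∑ i, v₀ i with hs₀
    set s₁ := ∑ i, v₁ i with hs₁
    have hwk : ∀ k, w k = -(E k 0 * s₀ + E k 1 * s₁) := by
      intro k
      have hk : (∑ i, B i) k = ∑ i, B i k := Finset.sum_apply k _ _
      rw [hw, Pi.neg_apply, hk, Finset.sum_congr rfl fun i _ => hE i k,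
        Finset.sum_add_distrib, ← Finset.mul_sum, ← Finset.mul_sum]
    have hs : s₀ ≠ 0 ∨ s₁ ≠ 0 := by
      by_contra! h
      refine hw0 (funext fun k => ?_)
      rw [hwk, h.1, h.2]
      simp
    have hcpos : 0 < Int.gcd s₀ s₁ := Int.gcd_pos_iff.2 hs
    obtain ⟨t₀, ht₀⟩ := Int.gcd_dvd_left s₀ s₁
    obtain ⟨t₁, ht₁⟩ := Int.gcd_dvd_right s₀ s₁
    have hbez := Int.gcd_eq_gcd_ab s₀ s₁
    set c : ℕ := Int.gcd s₀ s₁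
    set p := Int.gcdA s₀ s₁
    set q := Int.gcdB s₀ s₁
    have hc0 : (c : ℤ) ≠ 0 := by exact_mod_cast hcpos.ne'
    have hbez' : t₀ * p + t₁ * q = 1 := by
      refine mul_left_cancel₀ hc0 ?_
      conv_rhs => rw [mul_one, hbez, ht₀, ht₁]
      ring
    have hsum : ∀ α β : ℤ, ∑ i, (α • v₀ + β • v₁) i = α * s₀ + β * s₁ := fun α β => by
      simp only [Pi.add_apply, Pi.smul_apply, smul_eq_mul, Finset.sum_add_distrib,
        ← Finset.mul_sum, hs₀, hs₁]
    have hsq : E.det.sign * E.det.sign = 1 := by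
      rw [← Int.sign_mul, Int.sign_eq_one_of_pos (mul_self_pos.2 hdet0)]
    refine ⟨c, (E.det.sign * t₁) • v₀ + (-(E.det.sign * t₀)) • v₁, hcpos, ?_, ?_, ?_, ?_, ?_, ?_,
      ?_⟩
    · intro h0
      obtain ⟨h1, h2⟩ := huniq _ _ 0 0 (by rw [h0]; simp)
      refine one_ne_zero (α := ℤ) ?_
      calc (1 : ℤ) = (E.det.sign * E.det.sign) * (t₀ * p + t₁ * q) := by rw [hsq, hbez', one_mul]
        _ = E.det.sign * (-(-(E.det.sign * t₀)) * p + (E.det.sign * t₁) * q) := by ring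
        _ = 0 := by rw [h1, h2]; ring
    · exact M.add_mem (M.smul_mem _ hmem₀) (M.smul_mem _ hmem₁)
    · rw [hsum, ht₀, ht₁]
      ring
    · intro x hx
      obtain ⟨α, β, rfl⟩ := hexp x hx
      rw [hsum, ht₀, ht₁]
      exact ⟨α * t₀ + β * t₁, by ring⟩
    · refine ⟨p • v₀ + q • v₁, M.add_mem (M.smul_mem _ hmem₀) (M.smul_mem _ hmem₁), ?_⟩
      rw [hsum, hbez]
      ring
    · intro x hx hx0
      obtain ⟨α, β, rfl⟩ := hexp x hx
      rw [hsum] at hx0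
      have h0 : α * t₀ + β * t₁ = 0 := by
        refine mul_left_cancel₀ hc0 ?_
        rw [mul_zero, ← hx0]
        conv_rhs => rw [ht₀, ht₁]
        ring
      -- Here `(α, β)` is a multiple of `(t₁, -t₀)`; pairing it with the Bézout coefficients
      -- recovers the factor `q α - p β`.
      refine Submodule.mem_span_singleton.2 ⟨E.det.sign * (q * α - p * β), ?_⟩
      rw [smul_add, smul_smul, smul_smul]
      congr 2
      · linear_combination (q * α - p * β) * t₁ * hsq + α * hbez' - p * h0
      · linear_combination (-(q * α - p * β) * t₀) * hsq + β * hbez' - q * h0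
    · intro j
      have hsign := Int.sign_mul_natAbs E.det
      rw [det2_eq, hwk, hwk, hE, hE]
      simp only [Pi.add_apply, Pi.smul_apply, smul_eq_mul]
      have h1 : (E.det.natAbs : ℤ) * E.det.sign = E.det := by rw [mul_comm]; exact hsign
      have h2 := Matrix.det_fin_two E
      calc _ = (E 0 0 * E 1 1 - E 0 1 * E 1 0) * (s₁ * v₀ j - s₀ * v₁ j) := by ring
        _ = (E.det.natAbs * E.det.sign) * (s₁ * v₀ j - s₀ * v₁ j) := by rw [h1, h2]
        _ = _ := by
          conv_lhs => rw [ht₀, ht₁]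
          ring

end RankTwo

/-! ### Volumes of quotient configurations of codimension two -/

section Core

variable {σ : Type} [Fintype σ]

/-- The embedding of `ℤ^σ` into `ℤ^(Option σ)` onto the vectors of coordinate sum zero. -/
def balance (σ : Type) [Fintype σ] : (σ → ℤ) →ₗ[ℤ] (Option σ → ℤ) where
  toFun x o := o.elim (-∑ i, x i) x
  map_add' x y := by
    funext o
    cases o
    · simp [Finset.sum_add_distrib]; ring
    · rfl
  map_smul' a x := by
    funext o
    cases o
    · simp [Finset.mul_sum]
    · rfl

theorem balance_injective : Function.Injective (balance σ) := fun _ _ h =>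
  funext fun i => congrFun h (some i)

/-- The restriction of vectors in `ℤ^(Option σ)` to `σ`. -/
def restrictSome (σ : Type) : (Option σ → ℤ) →ₗ[ℤ] (σ → ℤ) := LinearMap.funLeft ℤ ℤ some

theorem coordSum_option (z : Option σ → ℤ) :
    coordSum (Option σ) z = z none + coordSum σ (restrictSome σ z) := by
  rw [coordSum_apply, coordSum_apply, Fintype.sum_option]
  rfl

theorem columnLattice_balance {B : Matrix σ (Fin 2) ℤ} {B' : Matrix (Option σ) (Fin 2) ℤ}
    (h₀ : B' none = -∑ i, B i) (h₁ : ∀ i, B' (some i) = B i) :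
    columnLattice B' = (columnLattice B).map (balance σ) := by
  rw [columnLattice, columnLattice, Submodule.map_span, ← Set.range_comp]
  congr 2
  funext k o
  cases o with
  | none =>
    rw [h₀]
    have hk : (∑ i, B i) k = ∑ i, B i k := Finset.sum_apply k _ _
    change -((∑ i, B i) k) = -∑ i, B i k
    rw [hk]
  | some i => rw [h₁]; rfl

variable {m : ℕ}

theorem mem_ker_prod_coordSum {τ : Type} [Fintype τ] (φ : (τ → ℤ) →ₗ[ℤ] (Fin m → ℤ))
    (x : τ → ℤ) : x ∈ LinearMap.ker (φ.prod (coordSum τ)) ↔ φ x = 0 ∧ coordSum τ x = 0 :=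
  Prod.mk_eq_zero

/-- The extra coordinate is free in the kernel of `φ` and is determined by the condition of degree
zero. -/
theorem ker_prod_coordSum (φ : (σ → ℤ) →ₗ[ℤ] (Fin m → ℤ)) :
    LinearMap.ker ((φ.comp (restrictSome σ)).prod (coordSum (Option σ))) =
      (LinearMap.ker φ).map (balance σ) := by
  ext z
  rw [mem_ker_prod_coordSum, Submodule.mem_map, coordSum_option]
  constructor
  · rintro ⟨h1, h2⟩
    refine ⟨restrictSome σ z, h1, ?_⟩
    funext o
    cases o with
    | none =>
      rw [coordSum_apply] at h2
      change -∑ i, _ = z none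
      linarith
    | some i => rfl
  · rintro ⟨x, hx, rfl⟩
    refine ⟨hx, ?_⟩
    rw [coordSum_apply]
    change -∑ i, x i + ∑ i, x i = 0
    ring

theorem card_ker_gradedMap (φ : (σ → ℤ) →ₗ[ℤ] (Fin m → ℤ)) (Λ : Submodule ℤ (σ → ℤ))
    (hΛ : Λ ≤ LinearMap.ker (φ.prod (coordSum σ))) :
    Nat.card (LinearMap.ker (gradedMap φ Λ hΛ)) =
      Λ.toAddSubgroup.relIndex (LinearMap.ker (φ.prod (coordSum σ))).toAddSubgroup := by
  have h := AddSubgroup.relIndex_ker Λ.mkQ.toAddMonoidHom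
    (K := (LinearMap.ker (φ.prod (coordSum σ))).toAddSubgroup)
  have hker : Λ.mkQ.toAddMonoidHom.ker = Λ.toAddSubgroup := by
    ext x
    exact Submodule.Quotient.mk_eq_zero Λ
  rw [hker] at h
  rw [h, gradedMap, Submodule.ker_liftQ]
  rfl

/-- The target of `gradedMap` is torsion-free, so torsion lies in the kernel; saturation gives the
converse. -/
theorem torsion_eq_ker_gradedMap (φ : (σ → ℤ) →ₗ[ℤ] (Fin m → ℤ)) (Λ : Submodule ℤ (σ → ℤ))
    (hΛ : Λ ≤ LinearMap.ker (φ.prod (coordSum σ)))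
    (hsat : ∀ x ∈ LinearMap.ker (φ.prod (coordSum σ)), ∃ N : ℤ, N ≠ 0 ∧ N • x ∈ Λ) :
    Submodule.torsion ℤ ((σ → ℤ) ⧸ Λ) = LinearMap.ker (gradedMap φ Λ hΛ) := by
  ext g
  obtain ⟨x, rfl⟩ := Submodule.Quotient.mk_surjective Λ g
  rw [Submodule.mem_torsion_iff, LinearMap.mem_ker]
  constructor
  · rintro ⟨a, ha⟩
    have h := congrArg (gradedMap φ Λ hΛ) ha
    rw [map_zero, Submonoid.smul_def, map_smul] at h
    exact (smul_eq_zero.1 h).resolve_left (nonZeroDivisors.coe_ne_zero a)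
  · intro h
    obtain ⟨N, hN, hNx⟩ := hsat x h
    refine ⟨⟨N, mem_nonZeroDivisors_of_ne_zero hN⟩, ?_⟩
    rw [Submonoid.smul_def, ← Submodule.Quotient.mk_smul]
    exact (Submodule.Quotient.mk_eq_zero Λ).2 hNx

variable {B : Matrix σ (Fin 2) ℤ} {B' : Matrix (Option σ) (Fin 2) ℤ}

theorem columnLattice_le_ker (h₀ : B' none = -∑ i, B i) (h₁ : ∀ i, B' (some i) = B i)
    {φ : (σ → ℤ) →ₗ[ℤ] (Fin m → ℤ)} (hφ : IsSaturationOf (LinearMap.ker φ) (columnLattice B)) :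
    columnLattice B' ≤ LinearMap.ker ((φ.comp (restrictSome σ)).prod (coordSum (Option σ))) := by
  rw [columnLattice_balance h₀ h₁, ker_prod_coordSum]
  exact Submodule.map_mono hφ.le

theorem exists_smul_mem_columnLattice (h₀ : B' none = -∑ i, B i) (h₁ : ∀ i, B' (some i) = B i)
    {φ : (σ → ℤ) →ₗ[ℤ] (Fin m → ℤ)} (hφ : IsSaturationOf (LinearMap.ker φ) (columnLattice B))
    (x : Option σ → ℤ)
    (hx : x ∈ LinearMap.ker ((φ.comp (restrictSome σ)).prod (coordSum (Option σ)))) :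
    ∃ N : ℤ, N ≠ 0 ∧ N • x ∈ columnLattice B' := by
  rw [ker_prod_coordSum] at hx
  obtain ⟨y, hy, rfl⟩ := hx
  obtain ⟨N, hN, hNy⟩ := (hφ y).1 hy
  refine ⟨N, hN, ?_⟩
  rw [columnLattice_balance h₀ h₁]
  exact ⟨N • y, hNy, map_smul _ _ _⟩

theorem torsionOrder_eq_card (h₀ : B' none = -∑ i, B i) (h₁ : ∀ i, B' (some i) = B i)
    {φ : (σ → ℤ) →ₗ[ℤ] (Fin m → ℤ)} (hφ : IsSaturationOf (LinearMap.ker φ) (columnLattice B)) :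
    torsionOrder B' = Nat.card (LinearMap.ker (gradedMap (φ.comp (restrictSome σ))
      (columnLattice B') (columnLattice_le_ker h₀ h₁ hφ))) := by
  have h := torsion_eq_ker_gradedMap _ _ (columnLattice_le_ker h₀ h₁ hφ)
    (exists_smul_mem_columnLattice h₀ h₁ hφ)
  exact congrArg (fun S : Submodule ℤ ((Option σ → ℤ) ⧸ columnLattice B') => Nat.card S) h

theorem torsionOrder_eq_relIndex (h₀ : B' none = -∑ i, B i) (h₁ : ∀ i, B' (some i) = B i)
    {φ : (σ → ℤ) →ₗ[ℤ] (Fin m → ℤ)} (hφ : IsSaturationOf (LinearMap.ker φ) (columnLattice B)) :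
    torsionOrder B' =
      (columnLattice B).toAddSubgroup.relIndex (LinearMap.ker φ).toAddSubgroup := by
  rw [torsionOrder_eq_card h₀ h₁ hφ, card_ker_gradedMap, ker_prod_coordSum,
    columnLattice_balance h₀ h₁]
  have h := AddSubgroup.relIndex_map_map_of_injective (columnLattice B).toAddSubgroup
    (LinearMap.ker φ).toAddSubgroup (f := (balance σ).toAddMonoidHom) balance_injective
  exact h

/-- The convex hull of the origin and of the images of the unit vectors under a surjection onto
`ℤ^m` has positive volume. -/
theorem volume_convexHull_ne_zero [DecidableEq σ] (φ : (σ → ℤ) →ₗ[ℤ] (Fin m → ℤ))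
    (hφ : Function.Surjective φ) :
    MeasureTheory.volume (convexHull ℝ
      (insert 0 (Set.range fun i => castVec (φ (Pi.single i 1))))) ≠ 0 := by
  refine (MeasureTheory.Measure.measure_pos_of_nonempty_interior _ ?_).ne'
  rw [interior_convexHull_nonempty_iff_affineSpan_eq_top]
  refine SetLike.coe_injective ?_
  rw [affineSpan_insert_zero, AffineSubspace.top_coe]
  refine Set.eq_univ_of_forall fun y => ?_
  have hmem : ∀ z : Fin m → ℤ,
      castVec z ∈ Submodule.span ℝ (Set.range fun i => castVec (φ (Pi.single i 1))) := by
    intro z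
    obtain ⟨x, rfl⟩ := hφ z
    rw [castVec_map]
    exact Submodule.sum_mem _ fun i _ => Submodule.smul_mem _ _ (Submodule.subset_span ⟨i, rfl⟩)
  have hy : y = ∑ k, y k • castVec (Pi.single k 1) := by
    funext k
    simp [castVec_apply, Pi.single_apply]
  rw [hy]
  exact Submodule.sum_mem _ fun k _ => Submodule.smul_mem _ _ (hmem _)

omit [Fintype σ] in
theorem range_option [DecidableEq σ] (φ : (σ → ℤ) →ₗ[ℤ] (Fin m → ℤ)) :
    (Set.range fun o => castVec ((φ.comp (restrictSome σ)) (Pi.single o 1))) =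
      insert 0 (Set.range fun i => castVec (φ (Pi.single i 1))) := by
  have hnone : restrictSome σ (Pi.single none 1) = 0 := by
    funext i
    simp [restrictSome, LinearMap.funLeft_apply]
  have hsome : ∀ i, restrictSome σ (Pi.single (some i) 1) = Pi.single i 1 := by
    intro i
    funext j
    simp [restrictSome, LinearMap.funLeft_apply, Pi.single_apply]
  ext y
  constructor
  · rintro ⟨o, rfl⟩
    cases o with
    | none => left; simp only [LinearMap.comp_apply, hnone, map_zero]
    | some i => right; exact ⟨i, by simp only [LinearMap.comp_apply, hsome]⟩
  · rintro (rfl | ⟨i, rfl⟩)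
    · exact ⟨none, by simp only [LinearMap.comp_apply, hnone, map_zero]⟩
    · exact ⟨some i, by simp only [LinearMap.comp_apply, hsome]⟩

theorem degree_latticeIdeal_eq [DecidableEq σ] (hB : ColumnsIndependent B)
    (h₀ : B' none = -∑ i, B i)
    (h₁ : ∀ i, B' (some i) = B i) {φ : (σ → ℤ) →ₗ[ℤ] (Fin m → ℤ)} (hsurj : Function.Surjective φ)
    (hφ : IsSaturationOf (LinearMap.ker φ) (columnLattice B)) :
    (degree (latticeIdeal B') : ℝ) = m.factorial * (torsionOrder B' * (MeasureTheory.volume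
      (convexHull ℝ (insert 0 (Set.range fun i => castVec (φ (Pi.single i 1)))))).toReal) := by
  classical
  obtain ⟨g, hg, hindex, -⟩ := columnLattice_saturation hB hφ
  have hT : torsionOrder B' ≠ 0 := by
    rw [torsionOrder_eq_relIndex h₀ h₁ hφ, hindex]
    exact hg.ne'
  have hle := columnLattice_le_ker h₀ h₁ hφ
  have hcard := torsionOrder_eq_card h₀ h₁ hφ
  have hfin : Finite (LinearMap.ker (gradedMap (φ.comp (restrictSome σ)) (columnLattice B') hle)) :=
    Nat.finite_of_card_ne_zero (hcard ▸ hT)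
  have hrestr : Function.Surjective (restrictSome σ) :=
    LinearMap.funLeft_surjective_of_injective ℤ ℤ some (Option.some_injective σ)
  -- The additional unit vector has degree one and maps to `0`, so `c = 1`, and it contributes the
  -- origin to the convex hull.
  have hlim := tendsto_classCount (φ.comp (restrictSome σ)) (columnLattice B') hle 1
    (hsurj.comp hrestr) one_pos (fun x _ => by simp) ⟨Pi.single none 1, by
      have : restrictSome σ (Pi.single none 1) = 0 := by
        funext i
        simp [restrictSome, LinearMap.funLeft_apply]
      rw [LinearMap.comp_apply, this, map_zero], by rw [coordSum_apply]; simp⟩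
  rw [← hcard, range_option] at hlim
  simp only [Nat.cast_one, mul_one, ← hilbertFunction_latticeIdeal] at hlim
  refine degree_eq_of_tendsto _ ?_ m _ ?_ hlim
  · simp only [hilbertFunction_latticeIdeal]
    refine eventuallyPolynomial_classCount _ fun l hl => ?_
    rw [← coordSum_apply]
    exact ((mem_ker_prod_coordSum _ _).1 (hle hl)).2
  · refine mul_ne_zero (by exact_mod_cast hT) (ENNReal.toReal_ne_zero.2 ⟨?_, ?_⟩)
    · exact volume_convexHull_ne_zero φ hsurj
    · exact (((Set.finite_range _).insert _).isCompact_convexHull ℝ).measure_lt_top.ne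

/-- The degree vanishes on `ker φ`, so it factors through `φ` as a linear functional. This
functional equals `1` at every `φ(e_i)`, which places the hull in a hyperplane. -/
theorem volume_convexHull_eq_zero [DecidableEq σ] (φ : (σ → ℤ) →ₗ[ℤ] (Fin m → ℤ))
    (hsurj : Function.Surjective φ) (hsum : ∀ x, φ x = 0 → ∑ i, x i = 0) :
    MeasureTheory.volume (convexHull ℝ (Set.range fun i => castVec (φ (Pi.single i 1)))) = 0 := by
  choose s hs using hsurj
  let a : Fin m → ℝ := fun k => ((∑ i, s (Pi.single k 1) i : ℤ) : ℝ)
  let H : AffineSubspace ℝ (Fin m → ℝ) :=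
    { carrier := {y | ∑ k, y k * a k = 1}
      smul_vsub_vadd_mem' := by
        intro c p₁ p₂ p₃ h₁ h₂ h₃
        simp only [Set.mem_ofPred_eq] at h₁ h₂ h₃ ⊢
        simp only [vsub_eq_sub, vadd_eq_add, Pi.add_apply, Pi.smul_apply, Pi.sub_apply, smul_eq_mul,
          add_mul, sub_mul, mul_assoc, Finset.sum_add_distrib, ← Finset.mul_sum,
          Finset.sum_sub_distrib, h₁, h₂, h₃]
        ring }
  have hH : H ≠ ⊤ := by
    intro h
    have h0 : (0 : Fin m → ℝ) ∈ H := h ▸ AffineSubspace.mem_top ℝ _ _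
    change ∑ k, (0 : Fin m → ℝ) k * a k = 1 at h0
    simp at h0
  refine MeasureTheory.measure_mono_null (convexHull_min ?_ H.convex)
    (MeasureTheory.Measure.addHaar_affineSubspace _ H hH)
  rintro _ ⟨i, rfl⟩
  change ∑ k, castVec (φ (Pi.single i 1)) k * a k = 1
  set y := φ (Pi.single i 1) with hy
  have h := hsum (Pi.single i 1 - ∑ k, y k • s (Pi.single k 1)) (by
    rw [map_sub, map_sum, sub_eq_zero]
    simp only [map_smul, hs]
    funext k
    simp [Pi.single_apply, ← hy])
  simp only [Pi.sub_apply, Finset.sum_apply, Pi.smul_apply, smul_eq_mul, Finset.sum_sub_distrib,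
    Finset.sum_pi_single', Finset.mem_univ, if_true] at h
  rw [Finset.sum_comm] at h
  simp only [← Finset.mul_sum] at h
  have h' : ∑ k, y k * ∑ i, s (Pi.single k 1) i = 1 := by linarith
  simp only [castVec_apply, a]
  exact_mod_cast h'

theorem volume_convexHull_eq [DecidableEq σ] (hB : ColumnsIndependent B)
    {φ : (σ → ℤ) →ₗ[ℤ] (Fin m → ℤ)} (hsurj : Function.Surjective φ)
    (hφ : IsSaturationOf (LinearMap.ker φ) (columnLattice B)) (w : Fin 2 → ℤ)
    (hw : w = -∑ i, B i) :
    m.factorial * (MeasureTheory.volume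
      (convexHull ℝ (Set.range fun i => castVec (φ (Pi.single i 1))))).toReal =
    ((∑ j with 0 < det2 w (B j), det2 w (B j) : ℤ) : ℝ) /
      ((columnLattice B).toAddSubgroup.relIndex (LinearMap.ker φ).toAddSubgroup : ℝ) := by
  classical
  obtain ⟨g, hg, hindex, -, hmain⟩ := columnLattice_saturation hB hφ
  rw [hindex]
  by_cases hw0 : w = 0
  · rw [volume_convexHull_eq_zero φ hsurj]
    · simp [hw0, det2_eq]
    · intro x hx
      obtain ⟨N, hN, hNx⟩ := (hφ x).1 hx
      have hcol : columnLattice B ≤ LinearMap.ker (coordSum σ) := by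
        refine Submodule.span_le.2 ?_
        rintro _ ⟨k, rfl⟩
        have hk : (∑ i, B i) k = ∑ i, B i k := Finset.sum_apply k _ _
        rw [SetLike.mem_coe, LinearMap.mem_ker, coordSum_apply]
        change ∑ i, B i k = 0
        rw [← hk, ← neg_neg (∑ i, B i), ← hw, hw0]
        rfl
      have h := hcol hNx
      rw [LinearMap.mem_ker, map_smul, coordSum_apply] at h
      exact (smul_eq_zero.1 h).resolve_left hN
  · obtain ⟨c, v, hc, hv0, hvM, hvsum, hdvd, ⟨x₀, hx₀, hx₀c⟩, hspan, hdet⟩ := hmain w hw hw0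
    have hrank : Fintype.card σ = m + 2 := by
      obtain ⟨b⟩ := exists_basis_of_saturation hB hφ
      have h := Submodule.finrank_quotient_add_finrank (LinearMap.ker φ)
      rw [(φ.quotKerEquivOfSurjective hsurj).finrank_eq, Module.finrank_eq_card_basis b,
        Module.finrank_fin_fun, Fintype.card_fin, Module.finrank_fintype_fun_eq_card] at h
      exact h.symm
    have hΛ : Submodule.span ℤ {v} ≤ LinearMap.ker (φ.prod (coordSum σ)) := by
      rw [Submodule.span_singleton_le_iff_mem, mem_ker_prod_coordSum, coordSum_apply]
      exact ⟨hvM, hvsum⟩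
    -- The span of `v` is the whole degree-zero part of `ker φ`, so the index in the asymptotic
    -- count is one.
    have hone : Nat.card (LinearMap.ker (gradedMap φ _ hΛ)) = 1 := by
      rw [card_ker_gradedMap, AddSubgroup.relIndex_eq_one]
      intro x hx
      obtain ⟨h1, h2⟩ := (mem_ker_prod_coordSum φ x).1 hx
      exact hspan x h1 (by rwa [coordSum_apply] at h2)
    have hfin : Finite (LinearMap.ker (gradedMap φ _ hΛ)) :=
      Nat.finite_of_card_ne_zero (by rw [hone]; exact one_ne_zero)
    have hne : Nonempty σ := Fintype.card_pos_iff.1 (by omega)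
    have hlim := tendsto_classCount φ _ hΛ c hsurj hc
      (fun x hx => by rw [coordSum_apply]; exact hdvd x hx)
      ⟨x₀, hx₀, by rw [coordSum_apply]; exact hx₀c⟩
    have hlim' := (tendsto_classCount_span_singleton v hv0 hvsum m hrank).mul_const (c : ℝ)
    simp only [div_mul_eq_mul_div] at hlim'
    -- The lattice-point count and the hypersurface count of the same classes are compared.
    have hvol := tendsto_nhds_unique hlim hlim'
    rw [hone, Nat.cast_one, one_mul] at hvol
    have hsum : (∑ j with 0 < det2 w (B j), det2 w (B j) : ℤ) =
        g * c * ((∑ i, (v i).toNat : ℕ) : ℤ) := by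
      have hgc : (0 : ℤ) < g * c := by positivity
      rw [Finset.sum_filter, Nat.cast_sum, Finset.mul_sum]
      refine Finset.sum_congr rfl fun j _ => ?_
      rw [hdet]
      by_cases hj : 0 < v j
      · rw [if_pos (mul_pos hgc hj), Int.toNat_of_nonneg hj.le]
      · rw [if_neg fun h => hj (pos_of_mul_pos_right h hgc.le), Int.toNat_of_nonpos (not_lt.1 hj)]
        simp
    have hg' : (g : ℝ) ≠ 0 := by positivity
    have hm : (m.factorial : ℝ) ≠ 0 := by positivity
    rw [hvol, hsum]
    push_cast
    field_simp

end Core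

/-! ### Volumes and torsion for an abstract lattice quotient -/

section Quotient

variable {σ : Type} [Fintype σ] {B : Matrix σ (Fin 2) ℤ} {B' : Matrix (Option σ) (Fin 2) ℤ}
  {L : Type} [AddCommGroup L] [Module.Free ℤ L] [Module.Finite ℤ L]

/-- A homomorphism to a lattice in coordinates. -/
def coordMap (π : (σ → ℤ) →ₗ[ℤ] L) : (σ → ℤ) →ₗ[ℤ] (Fin (Module.finrank ℤ L) → ℤ) :=
  (Module.finBasis ℤ L).equivFun.toLinearMap.comp π

omit [Fintype σ] in
theorem ker_coordMap (π : (σ → ℤ) →ₗ[ℤ] L) : LinearMap.ker (coordMap π) = LinearMap.ker π :=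
  LinearEquiv.ker_comp _ _

omit [Fintype σ] in
theorem coordMap_surjective {π : (σ → ℤ) →ₗ[ℤ] L} (hπ : Function.Surjective π) :
    Function.Surjective (coordMap π) :=
  (Module.finBasis ℤ L).equivFun.surjective.comp hπ

theorem normalizedVolume_eq_castVec (S : Set L) :
    normalizedVolume L S = (Module.finrank ℤ L).factorial * (MeasureTheory.volume
      (convexHull ℝ ((fun x => castVec ((Module.finBasis ℤ L).equivFun x)) '' S))).toReal :=
  rfl

theorem torsionOrder_eq_relIndex_ker (h₀ : B' none = -∑ i, B i) (h₁ : ∀ i, B' (some i) = B i)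
    {π : (σ → ℤ) →ₗ[ℤ] L} (hker : IsSaturationOf (LinearMap.ker π) (columnLattice B)) :
    torsionOrder B' = (columnLattice B).toAddSubgroup.relIndex (LinearMap.ker π).toAddSubgroup := by
  rw [← ker_coordMap π] at hker ⊢
  exact torsionOrder_eq_relIndex h₀ h₁ hker

theorem torsionOrder_eq_gcd (hB : ColumnsIndependent B) (h₀ : B' none = -∑ i, B i)
    (h₁ : ∀ i, B' (some i) = B i)
    {π : (σ → ℤ) →ₗ[ℤ] L} (hker : IsSaturationOf (LinearMap.ker π) (columnLattice B)) :
    (torsionOrder B' : ℤ) =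
      (Finset.univ : Finset (σ × σ)).gcd fun p => det2 (B p.1) (B p.2) := by
  obtain ⟨g, -, hindex, hgcd, -⟩ := columnLattice_saturation hB hker
  rw [torsionOrder_eq_relIndex_ker h₀ h₁ hker, hindex, hgcd]

theorem normalizedVolume_insert_zero [DecidableEq σ] (hB : ColumnsIndependent B)
    (h₀ : B' none = -∑ i, B i) (h₁ : ∀ i, B' (some i) = B i)
    {π : (σ → ℤ) →ₗ[ℤ] L} (hπ : Function.Surjective π)
    (hker : IsSaturationOf (LinearMap.ker π) (columnLattice B)) :
    normalizedVolume L (insert 0 (Set.range fun i => π (Pi.single i 1))) =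
      (degree (latticeIdeal B') : ℝ) / (torsionOrder B' : ℝ) := by
  obtain ⟨g, hg, hindex, -⟩ := columnLattice_saturation hB hker
  have hT : (torsionOrder B' : ℝ) ≠ 0 := by
    rw [torsionOrder_eq_relIndex_ker h₀ h₁ hker, hindex]
    positivity
  rw [normalizedVolume_eq_castVec, Set.image_insert_eq, ← Set.range_comp, map_zero, map_zero,
    degree_latticeIdeal_eq hB h₀ h₁ (coordMap_surjective hπ) (by rwa [ker_coordMap])]
  rw [mul_left_comm, mul_div_cancel_left₀ _ hT]
  rfl

theorem normalizedVolume_range [DecidableEq σ] (hB : ColumnsIndependent B)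
    (h₀ : B' none = -∑ i, B i) (h₁ : ∀ i, B' (some i) = B i)
    {π : (σ → ℤ) →ₗ[ℤ] L} (hπ : Function.Surjective π)
    (hker : IsSaturationOf (LinearMap.ker π) (columnLattice B)) :
    normalizedVolume L (Set.range fun i => π (Pi.single i 1)) =
      ((∑ j with 0 < det2 (B' none) (B j), det2 (B' none) (B j) : ℤ) : ℝ) /
        (torsionOrder B' : ℝ) := by
  rw [torsionOrder_eq_relIndex_ker h₀ h₁ hker, normalizedVolume_eq_castVec, ← Set.range_comp]
  have h := volume_convexHull_eq hB (coordMap_surjective hπ) (by rwa [ker_coordMap]) _ h₀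
  rw [ker_coordMap] at h
  exact h

end Quotient

/-! ### Faces of the polytope of a toric matrix -/

section Faces

variable {d n : ℕ} {A : Matrix (Fin d) (Fin n) ℤ}

theorem castVec_point_mem_polytope (A : Matrix (Fin d) (Fin n) ℤ) (i : Fin n) :
    castVec (point A i) ∈ polytope A :=
  subset_convexHull ℝ _ ⟨i, rfl⟩

theorem IsToricMatrix.exists_functional (hA : IsToricMatrix A) :
    ∃ e : (Fin d → ℝ) →ₗ[ℝ] ℝ, ∀ i, e (castVec (point A i)) = 1 := by
  obtain ⟨c, hc⟩ := (Submodule.mem_span_range_iff_exists_fun ℚ).1 hA.ones_mem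
  refine ⟨∑ k, (c k : ℝ) • LinearMap.proj k, fun i => ?_⟩
  have h := congrFun hc i
  simp only [Finset.sum_apply, Pi.smul_apply, smul_eq_mul] at h
  simp only [LinearMap.sum_apply, LinearMap.smul_apply, LinearMap.proj_apply, smul_eq_mul,
    castVec_apply, point]
  exact_mod_cast h

/-- A face is the zero set of a linear functional that is nonnegative on the polytope. -/
theorem IsFace.exists_functional (hA : IsToricMatrix A) {β : Set (Fin d → ℝ)} (hβ : IsFace A β) :
    ∃ g : (Fin d → ℝ) →ₗ[ℝ] ℝ, (∀ i, 0 ≤ g (castVec (point A i))) ∧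
      ∀ x, x ∈ β ↔ x ∈ polytope A ∧ g x = 0 := by
  obtain ⟨e, he⟩ := hA.exists_functional
  obtain ⟨l, hl⟩ := hβ.exposed hβ.nonempty
  obtain ⟨x₀, hx₀⟩ := hβ.nonempty
  rw [hl] at hx₀
  have hepoly : ∀ x ∈ polytope A, e x = 1 := by
    intro x hx
    obtain ⟨w, -, hw1, rfl⟩ := (mem_convexHull_range_iff _ _).1 hx
    simp [he, hw1]
  -- Since `e = 1` on the polytope, the affine function `max l - l` is the restriction of a linear
  -- one.
  refine ⟨l x₀ • e - l.toLinearMap, fun i => ?_, fun x => ?_⟩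
  · have h := hx₀.2 _ (castVec_point_mem_polytope A i)
    simp only [LinearMap.sub_apply, LinearMap.smul_apply, he, smul_eq_mul, mul_one]
    exact sub_nonneg.2 h
  · rw [hl]
    refine and_congr_right fun hx => ?_
    simp only [LinearMap.sub_apply, LinearMap.smul_apply, hepoly x hx, smul_eq_mul, mul_one]
    constructor
    · intro h
      exact sub_eq_zero.2 (le_antisymm (h x₀ hx₀.1) (hx₀.2 x hx))
    · intro h y hy
      have h' : l x₀ = l x := sub_eq_zero.1 h
      rw [← h']
      exact hx₀.2 y hy

/-- The points of a face are the convex combinations of the columns of `A` lying on it. -/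
theorem exists_weights_of_mem {β : Set (Fin d → ℝ)} {g : (Fin d → ℝ) →ₗ[ℝ] ℝ}
    (hg0 : ∀ i, 0 ≤ g (castVec (point A i))) (hg : ∀ x, x ∈ β ↔ x ∈ polytope A ∧ g x = 0)
    {x : Fin d → ℝ} (hx : x ∈ β) :
    ∃ w : Fin n → ℝ, ∑ i, w i = 1 ∧ (∀ i, castVec (point A i) ∉ β → w i = 0) ∧
      ∑ i, w i • castVec (point A i) = x := by
  obtain ⟨hxP, hgx⟩ := (hg x).1 hx
  obtain ⟨w, hw0, hw1, rfl⟩ := (mem_convexHull_range_iff _ _).1 hxP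
  refine ⟨w, hw1, fun i hi => ?_, rfl⟩
  rw [map_sum] at hgx
  have h := (Finset.sum_eq_zero_iff_of_nonneg fun i _ => by
    rw [map_smul]; exact mul_nonneg (hw0 i) (hg0 i)).1 hgx i (Finset.mem_univ i)
  rw [map_smul, smul_eq_mul, mul_eq_zero] at h
  exact h.resolve_right fun h0 => hi ((hg _).2 ⟨castVec_point_mem_polytope A i, h0⟩)

theorem mem_faceLattice_iff (A : Matrix (Fin d) (Fin n) ℤ) (α : Set (Fin d → ℝ))
    (v : Fin d → ℤ) : v ∈ faceLattice A α ↔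
      ∃ x : Fin n → ℤ, (∀ i, castVec (point A i) ∉ α → x i = 0) ∧ ∑ i, x i • point A i = v := by
  constructor
  · intro hv
    refine Submodule.span_induction ?_ ?_ ?_ ?_ hv
    · rintro _ ⟨i, hi, rfl⟩
      refine ⟨Pi.single i 1, fun j hj => ?_, ?_⟩
      · exact Pi.single_eq_of_ne (by rintro rfl; exact hj hi) _
      · simp [Pi.single_apply, ite_smul]
    · exact ⟨0, fun _ _ => rfl, by simp⟩
    · rintro _ _ _ _ ⟨x, hx, rfl⟩ ⟨y, hy, rfl⟩
      exact ⟨x + y, fun i hi => by rw [Pi.add_apply, hx i hi, hy i hi, add_zero],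
        by simp [add_smul, Finset.sum_add_distrib]⟩
    · rintro a _ _ ⟨x, hx, rfl⟩
      exact ⟨a • x, fun i hi => by rw [Pi.smul_apply, hx i hi, smul_zero],
        by simp [mul_smul, Finset.smul_sum]⟩
  · rintro ⟨x, hx, rfl⟩
    refine Submodule.sum_mem _ fun i _ => ?_
    by_cases hi : castVec (point A i) ∈ α
    · exact Submodule.smul_mem _ _ (Submodule.subset_span ⟨i, hi, rfl⟩)
    · rw [hx i hi, zero_smul]
      exact Submodule.zero_mem _

theorem faceLattice_le_realSpan (A : Matrix (Fin d) (Fin n) ℤ) (β : Set (Fin d → ℝ)) :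
    faceLattice A β ≤ realSpan β := by
  refine Submodule.span_le.2 ?_
  rintro _ ⟨i, hi, rfl⟩
  exact Submodule.subset_span hi

theorem faceLattice_le_faceLattice_polytope (A : Matrix (Fin d) (Fin n) ℤ)
    (β : Set (Fin d → ℝ)) : faceLattice A β ≤ faceLattice A (polytope A) := by
  refine Submodule.span_mono ?_
  rintro _ ⟨i, -, rfl⟩
  exact ⟨i, castVec_point_mem_polytope A i, rfl⟩

/-- Applied to the coefficients, `r` turns a real linear relation between integer vectors into a
rational one. -/
theorem exists_rat_retraction : ∃ r : ℝ →ₗ[ℚ] ℚ, ∀ (x : ℝ) (a : ℤ), r (x * a) = r x * a ∧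
    r a = a := by
  obtain ⟨r, hr⟩ := LinearMap.exists_leftInverse_of_injective (Algebra.linearMap ℚ ℝ)
    (LinearMap.ker_eq_bot.2 (algebraMap ℚ ℝ).injective)
  refine ⟨r, fun x a => ⟨?_, ?_⟩⟩
  · rw [mul_comm, ← zsmul_eq_mul, map_zsmul, zsmul_eq_mul, mul_comm]
  · have h := congrArg (fun f => f (a : ℚ)) hr
    simpa using h

theorem mem_realSpan_iff {β : Set (Fin d → ℝ)} {g : (Fin d → ℝ) →ₗ[ℝ] ℝ}
    (hg0 : ∀ i, 0 ≤ g (castVec (point A i))) (hg : ∀ x, x ∈ β ↔ x ∈ polytope A ∧ g x = 0)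
    (v : Fin d → ℤ) : v ∈ realSpan β ↔ ∃ N : ℤ, N ≠ 0 ∧ N • v ∈ faceLattice A β := by
  constructor
  · intro hv
    have hw : ∃ w : Fin n → ℝ, (∀ i, castVec (point A i) ∉ β → w i = 0) ∧
        ∑ i, w i • castVec (point A i) = castVec v := by
      refine Submodule.span_induction (p := fun y _ => ∃ w : Fin n → ℝ,
        (∀ i, castVec (point A i) ∉ β → w i = 0) ∧ ∑ i, w i • castVec (point A i) = y)
        ?_ ?_ ?_ ?_ hv
      · intro x hx
        obtain ⟨w, -, hw⟩ := exists_weights_of_mem hg0 hg hx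
        exact ⟨w, hw⟩
      · exact ⟨0, fun _ _ => rfl, by simp⟩
      · rintro _ _ _ _ ⟨x, hx, rfl⟩ ⟨y, hy, rfl⟩
        exact ⟨x + y, fun i hi => by rw [Pi.add_apply, hx i hi, hy i hi, add_zero],
          by simp [add_smul, Finset.sum_add_distrib]⟩
      · rintro a _ _ ⟨x, hx, rfl⟩
        exact ⟨a • x, fun i hi => by rw [Pi.smul_apply, hx i hi, smul_zero],
          by simp [mul_smul, Finset.smul_sum]⟩
    obtain ⟨w, hw0, hwv⟩ := hw
    obtain ⟨r, hr⟩ := exists_rat_retraction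
    -- Clearing the denominators of the rational coefficients `r (w i)` gives an integer relation
    -- supported on `β`.
    obtain ⟨N, hN⟩ := IsLocalization.exist_integer_multiples_of_finite (nonZeroDivisors ℤ)
      fun i => r (w i)
    choose x hx using hN
    refine ⟨N, nonZeroDivisors.coe_ne_zero N, (mem_faceLattice_iff A β _).2 ⟨x, fun i hi => ?_, ?_⟩⟩
    · have h := hx i
      rw [hw0 i hi, map_zero, smul_zero] at h
      simpa using h
    · funext k
      have h := congrArg r (congrFun hwv k)
      rw [castVec_apply, (hr 0 _).2, Finset.sum_apply, map_sum] at h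
      simp only [Pi.smul_apply, smul_eq_mul, castVec_apply, (hr _ _).1] at h
      simp only [Finset.sum_apply, Pi.smul_apply, smul_eq_mul]
      refine Int.cast_injective (α := ℚ) ?_
      push_cast
      rw [← h, Finset.mul_sum]
      refine Finset.sum_congr rfl fun i _ => ?_
      have h' := hx i
      rw [zsmul_eq_mul] at h'
      rw [← mul_assoc, ← h']
      rfl
  · rintro ⟨N, hN, h⟩
    have h' := faceLattice_le_realSpan A β h
    change castVec (N • v) ∈ Submodule.span ℝ β at h'
    change castVec v ∈ Submodule.span ℝ β
    rw [map_smul, ← Int.cast_smul_eq_zsmul ℝ] at h'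
    exact (Submodule.smul_mem_iff _ (Int.cast_ne_zero.2 hN)).1 h'

theorem eq_zero_of_mem_realSpan {β : Set (Fin d → ℝ)} {g : (Fin d → ℝ) →ₗ[ℝ] ℝ}
    (hg : ∀ x, x ∈ β ↔ x ∈ polytope A ∧ g x = 0) {v : Fin d → ℤ} (hv : v ∈ realSpan β) :
    g (castVec v) = 0 := by
  have hle : Submodule.span ℝ β ≤ LinearMap.ker g :=
    Submodule.span_le.2 fun x hx => ((hg x).1 hx).2
  exact hle hv

end Faces

/-! ### Gale duality for the quotient by a face -/

section Quotient

variable {d n : ℕ} {A : Matrix (Fin d) (Fin n) ℤ} {B : Matrix (Fin n) (Fin 2) ℤ}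
  {β : Set (Fin d → ℝ)}

open Classical in
theorem sum_galeIndex {M : Type*} [AddCommMonoid M] (f : Fin n → M) :
    ∑ i : GaleIndex A β, f i = ∑ i, if castVec (point A i) ∉ β then f i else 0 := by
  rw [← Finset.sum_filter]
  exact (Finset.sum_subtype _ (fun i => by simp) f).symm

/-- The combination of the columns of `A` outside `β` with given coefficients. -/
def outerSum (A : Matrix (Fin d) (Fin n) ℤ) (β : Set (Fin d → ℝ)) :
    (GaleIndex A β → ℤ) →ₗ[ℤ] (Fin d → ℤ) :=
  Fintype.linearCombination ℤ fun i : GaleIndex A β => point A i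

theorem outerSum_apply (y : GaleIndex A β → ℤ) : outerSum A β y = ∑ i, y i • point A i :=
  Fintype.linearCombination_apply ℤ _ y

theorem mulVec_eq_sum (A : Matrix (Fin d) (Fin n) ℤ) (x : Fin n → ℤ) :
    A.mulVecLin x = ∑ i, x i • point A i := by
  funext k
  simp [Matrix.mulVec, dotProduct, point, mul_comm]

theorem sum_sub_outerSum_mem (A : Matrix (Fin d) (Fin n) ℤ) (β : Set (Fin d → ℝ))
    (x : Fin n → ℤ) :
    ∑ i, x i • point A i - outerSum A β (fun i => x i) ∈ faceLattice A β := by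
  classical
  rw [outerSum_apply, sum_galeIndex (A := A) (β := β) fun i => x i • point A i,
    ← Finset.sum_sub_distrib]
  refine Submodule.sum_mem _ fun i _ => ?_
  by_cases hi : castVec (point A i) ∈ β
  · rw [if_neg (not_not.2 hi), sub_zero]
    exact Submodule.smul_mem _ _ (Submodule.subset_span ⟨i, hi, rfl⟩)
  · rw [if_pos hi, sub_self]
    exact Submodule.zero_mem _

theorem columnLattice_galeRows (A : Matrix (Fin d) (Fin n) ℤ) (B : Matrix (Fin n) (Fin 2) ℤ)
    (β : Set (Fin d → ℝ)) : columnLattice (galeRows A B β) =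
      (columnLattice B).map (LinearMap.funLeft ℤ ℤ fun i : GaleIndex A β => (i : Fin n)) := by
  rw [columnLattice, columnLattice, Submodule.map_span, ← Set.range_comp]
  rfl

theorem mem_columnLattice_galeRows_iff (hB : IsGaleDual A B) (y : GaleIndex A β → ℤ) :
    y ∈ columnLattice (galeRows A B β) ↔ outerSum A β y ∈ faceLattice A β := by
  classical
  rw [columnLattice_galeRows, hB]
  constructor
  · rintro ⟨x, hx, rfl⟩
    have h := sum_sub_outerSum_mem A β x
    rw [← mulVec_eq_sum, hx, zero_sub] at h
    exact (Submodule.neg_mem_iff _).1 h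
  · intro h
    obtain ⟨z, hz, hzy⟩ := (mem_faceLattice_iff A β _).1 h
    -- The extension of `y` by `-z` on `β` lies in the kernel of `A`, since `z` expresses the outer
    -- sum through columns on `β`.
    refine ⟨fun i => if hi : castVec (point A i) ∉ β then y ⟨i, hi⟩ else -z i, ?_, ?_⟩
    · rw [SetLike.mem_coe, LinearMap.mem_ker, mulVec_eq_sum]
      have h1 : outerSum A β y = ∑ i, if hi : castVec (point A i) ∉ β then
          y ⟨i, hi⟩ • point A i else 0 := by
        rw [outerSum_apply]
        have h2 := sum_galeIndex (A := A) (β := β) fun i =>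
          if hi : castVec (point A i) ∉ β then y ⟨i, hi⟩ • point A i else 0
        refine Eq.trans (Finset.sum_congr rfl fun i _ => ?_) (h2.trans
          (Finset.sum_congr rfl fun i _ => ?_))
        · rw [dif_pos i.2]
        · by_cases hi : castVec (point A i) ∉ β
          · rw [if_pos hi]
          · rw [if_neg hi, dif_neg hi]
      rw [← sub_eq_zero.2 (h1.symm.trans hzy.symm), ← Finset.sum_sub_distrib]
      refine Finset.sum_congr rfl fun i _ => ?_
      by_cases hi : castVec (point A i) ∉ β
      · rw [dif_pos hi, dif_pos hi, hz i hi, zero_smul, sub_zero]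
      · rw [dif_neg hi, dif_neg hi, neg_smul, zero_sub]
    · funext i
      exact dif_pos i.2

/-- The presentation of the quotient lattice by the columns of `A` outside `β`. -/
def quotientMap (A : Matrix (Fin d) (Fin n) ℤ) (β : Set (Fin d → ℝ)) :
    (GaleIndex A β → ℤ) →ₗ[ℤ] QuotientLattice A (polytope A) β :=
  ((realSpan β).submoduleOf (faceLattice A (polytope A))).mkQ.comp
    ((outerSum A β).codRestrict (faceLattice A (polytope A)) fun y => by
      rw [outerSum_apply]
      exact Submodule.sum_mem _ fun i _ => Submodule.smul_mem _ _
        (Submodule.subset_span ⟨i, castVec_point_mem_polytope A i, rfl⟩))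

theorem quotientMap_eq_iff (y : GaleIndex A β → ℤ) (v : faceLattice A (polytope A)) :
    quotientMap A β y = Submodule.Quotient.mk v ↔ outerSum A β y - v ∈ realSpan β :=
  Submodule.Quotient.eq _

theorem mem_ker_quotientMap_iff (y : GaleIndex A β → ℤ) :
    y ∈ LinearMap.ker (quotientMap A β) ↔ outerSum A β y ∈ realSpan β := by
  have h := quotientMap_eq_iff (A := A) (β := β) y 0
  rwa [Submodule.Quotient.mk_zero, Submodule.coe_zero, sub_zero] at h

theorem quotientMap_surjective : Function.Surjective (quotientMap A β) := by
  intro q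
  obtain ⟨⟨v, hv⟩, rfl⟩ := Submodule.Quotient.mk_surjective _ q
  obtain ⟨x, -, rfl⟩ := (mem_faceLattice_iff A _ _).1 hv
  refine ⟨fun i => x i, (quotientMap_eq_iff _ _).2 ?_⟩
  rw [← neg_sub]
  exact Submodule.neg_mem _ (faceLattice_le_realSpan A β (sum_sub_outerSum_mem A β x))

theorem isSaturationOf_ker_quotientMap (hB : IsGaleDual A B) {g : (Fin d → ℝ) →ₗ[ℝ] ℝ}
    (hg0 : ∀ i, 0 ≤ g (castVec (point A i))) (hg : ∀ x, x ∈ β ↔ x ∈ polytope A ∧ g x = 0) :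
    IsSaturationOf (LinearMap.ker (quotientMap A β)) (columnLattice (galeRows A B β)) := by
  intro y
  rw [mem_ker_quotientMap_iff, mem_realSpan_iff hg0 hg]
  refine exists_congr fun N => and_congr_right fun _ => ?_
  rw [mem_columnLattice_galeRows_iff hB, map_smul]

/-- The second isomorphism theorem: `ℤA ∩ ℝβ` is the sum of `ℤβ` and the image of the kernel under
`outerSum`, and the preimage of `ℤβ` is the column lattice of `B_β`. -/
theorem latticeIndex_eq_relIndex (hB : IsGaleDual A B) :
    latticeIndex A (polytope A) β = (columnLattice (galeRows A B β)).toAddSubgroup.relIndex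
      (LinearMap.ker (quotientMap A β)).toAddSubgroup := by
  have hcomap : (columnLattice (galeRows A B β)).toAddSubgroup =
      (faceLattice A β).toAddSubgroup.comap (outerSum A β).toAddMonoidHom := by
    ext y
    exact mem_columnLattice_galeRows_iff hB y
  have hsup : (faceLattice A (polytope A) ⊓ realSpan β) =
      (LinearMap.ker (quotientMap A β)).map (outerSum A β) ⊔ faceLattice A β := by
    refine le_antisymm ?_ (sup_le ?_ (le_inf (faceLattice_le_faceLattice_polytope A β)
      (faceLattice_le_realSpan A β)))
    · rintro v ⟨hvP, hv⟩
      obtain ⟨x, -, rfl⟩ := (mem_faceLattice_iff A _ _).1 hvP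
      have h := sum_sub_outerSum_mem A β x
      rw [← add_sub_cancel (outerSum A β fun i => x i) (∑ i, x i • point A i)]
      refine Submodule.add_mem_sup ⟨fun i => x i, ?_, rfl⟩ h
      rw [SetLike.mem_coe, mem_ker_quotientMap_iff]
      have h' := Submodule.sub_mem _ hv (faceLattice_le_realSpan A β h)
      rwa [sub_sub_cancel] at h'
    · rintro _ ⟨y, hy, rfl⟩
      refine ⟨?_, (mem_ker_quotientMap_iff y).1 hy⟩
      rw [outerSum_apply]
      exact Submodule.sum_mem _ fun i _ => Submodule.smul_mem _ _
        (Submodule.subset_span ⟨i, castVec_point_mem_polytope A i, rfl⟩)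
  have hsup' : (faceLattice A (polytope A) ⊓ realSpan β).toAddSubgroup =
      (LinearMap.ker (quotientMap A β)).toAddSubgroup.map (outerSum A β).toAddMonoidHom ⊔
        (faceLattice A β).toAddSubgroup := by
    rw [hsup, Submodule.sup_toAddSubgroup]
    rfl
  rw [latticeIndex, hsup', AddSubgroup.relIndex_sup_right, hcomap, AddSubgroup.relIndex_comap]

theorem quotientMap_single [DecidableEq (GaleIndex A β)] (i : GaleIndex A β) :
    quotientMap A β (Pi.single i 1) = Submodule.Quotient.mk
      ⟨point A i, Submodule.subset_span ⟨i, castVec_point_mem_polytope A i, rfl⟩⟩ := by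
  rw [quotientMap_eq_iff, outerSum, Fintype.linearCombination_apply_single, one_smul, sub_self]
  exact Submodule.zero_mem _

theorem quotientPoints_eq [DecidableEq (GaleIndex A β)] (hne : ∃ i, castVec (point A i) ∈ β) :
    quotientPoints A (polytope A) β =
      insert 0 (Set.range fun i => quotientMap A β (Pi.single i 1)) := by
  ext q
  constructor
  · rintro ⟨⟨_, hv⟩, ⟨i, -, rfl⟩, rfl⟩
    by_cases hi : castVec (point A i) ∈ β
    · left
      rw [Submodule.Quotient.mk_eq_zero]
      exact Submodule.subset_span hi
    · right
      exact ⟨⟨i, hi⟩, quotientMap_single _⟩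
  · rintro (rfl | ⟨i, rfl⟩)
    · obtain ⟨i, hi⟩ := hne
      refine ⟨⟨point A i, Submodule.subset_span ⟨i, castVec_point_mem_polytope A i, rfl⟩⟩,
        ⟨i, castVec_point_mem_polytope A i, rfl⟩, ?_⟩
      rw [Submodule.Quotient.mk_eq_zero]
      exact Submodule.subset_span hi
    · exact ⟨_, ⟨i, castVec_point_mem_polytope A i, rfl⟩, (quotientMap_single i).symm⟩

/-- Ensures that deleting `0` from `A_P/β` deletes none of the images of columns outside `β`. -/
theorem quotientMap_single_ne_zero [DecidableEq (GaleIndex A β)] {g : (Fin d → ℝ) →ₗ[ℝ] ℝ}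
    (hg : ∀ x, x ∈ β ↔ x ∈ polytope A ∧ g x = 0) (i : GaleIndex A β) :
    quotientMap A β (Pi.single i 1) ≠ 0 := by
  intro h
  rw [quotientMap_single, Submodule.Quotient.mk_eq_zero] at h
  exact i.2 ((hg _).2 ⟨castVec_point_mem_polytope A i, eq_zero_of_mem_realSpan hg h⟩)

theorem map_castVec_smul (g : (Fin d → ℝ) →ₗ[ℝ] ℝ) (a : ℤ) (v : Fin d → ℤ) :
    g (castVec (a • v)) = a * g (castVec v) := by
  rw [map_smul, ← Int.cast_smul_eq_zsmul ℝ, map_smul, smul_eq_mul]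

/-- Dependent columns put all rows of `B_β` on one line. Applying `g` to the relations `A B = 0`
gives `∑ g(a_i) b_i = 0` with all `g(a_i) > 0`. As the rows are nonzero, two of them point in
opposite directions, so the line is relevant. -/
theorem columnsIndependent_galeRows (hB : IsGaleDual A B) (hb : ∀ i, B i ≠ 0)
    (hproper : β ≠ polytope A) {g : (Fin d → ℝ) →ₗ[ℝ] ℝ}
    (hg0 : ∀ i, 0 ≤ g (castVec (point A i))) (hg : ∀ x, x ∈ β ↔ x ∈ polytope A ∧ g x = 0)
    (hrel : ¬ ∃ ℓ : Submodule ℝ (Fin 2 → ℝ), IsRelevantLine B ℓ ∧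
      ∀ i : GaleIndex A β, castVec (galeRows A B β i) ∈ ℓ) :
    ColumnsIndependent (galeRows A B β) := by
  classical
  intro a b hab
  by_contra hne
  have hsq : (0 : ℝ) < (a : ℝ) ^ 2 + (b : ℝ) ^ 2 := by
    have h : (0 : ℤ) < a ^ 2 + b ^ 2 := by
      rcases not_and_or.1 hne with h | h <;> positivity
    exact_mod_cast h
  let u : Fin 2 → ℝ := ![-b, a]
  -- The coordinate of the projection of `b_i` to the line through `u`, which is orthogonal to `(a,
  -- b)`.
  let t : Fin n → ℝ := fun i => (-b * B i 0 + a * B i 1) / ((a : ℝ) ^ 2 + (b : ℝ) ^ 2)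
  have ht : ∀ i : GaleIndex A β, castVec (B i) = t i • u := by
    intro i
    have h : (a : ℝ) * B i 0 + b * B i 1 = 0 := by exact_mod_cast hab i
    funext k
    fin_cases k
    · change (B i 0 : ℝ) = t i * -b
      simp only [t]
      field_simp
      linear_combination (a : ℝ) * h
    · change (B i 1 : ℝ) = t i * a
      simp only [t]
      field_simp
      linear_combination (b : ℝ) * h
  have hu : u ≠ 0 := by
    intro h
    have h0 : -(b : ℝ) = 0 := congrFun h 0
    have h1 : (a : ℝ) = 0 := congrFun h 1
    rw [h1, neg_eq_zero.1 h0] at hsq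
    simp at hsq
  have ht0 : ∀ i : GaleIndex A β, t i ≠ 0 := by
    intro i h
    refine hb i (castVec_injective ?_)
    rw [ht, h, zero_smul, map_zero]
  have hgpos : ∀ i : GaleIndex A β, 0 < g (castVec (point A i)) := fun i =>
    lt_of_le_of_ne (hg0 i) fun h => i.2 ((hg _).2 ⟨castVec_point_mem_polytope A i, h.symm⟩)
  have hcol : ∀ k, ∑ i : GaleIndex A β, g (castVec (point A i)) * (B i k : ℝ) = 0 := by
    intro k
    -- Columns on `β` drop out of the relation because `g` vanishes there.
    have h1 : (fun i => B i k) ∈ LinearMap.ker A.mulVecLin := by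
      rw [← hB]
      exact Submodule.subset_span ⟨k, rfl⟩
    rw [LinearMap.mem_ker, mulVec_eq_sum] at h1
    have h2 := congrArg (fun v => g (castVec v)) h1
    simp only [map_sum, map_zero, map_castVec_smul] at h2
    rw [sum_galeIndex (A := A) (β := β) fun i => g (castVec (point A i)) * (B i k : ℝ)]
    refine (Finset.sum_congr rfl fun i _ => ?_).trans h2
    by_cases hi : castVec (point A i) ∈ β
    · rw [if_neg (not_not.2 hi), ((hg _).1 hi).2, mul_zero]
    · rw [if_pos hi, mul_comm]
  have hsum : ∑ i : GaleIndex A β, g (castVec (point A i)) * t i = 0 := by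
    have h : ∀ i : GaleIndex A β, g (castVec (point A i)) * t i =
        ((-b) * (g (castVec (point A i)) * B i 0) + a * (g (castVec (point A i)) * B i 1)) /
          ((a : ℝ) ^ 2 + (b : ℝ) ^ 2) := fun i => by
      simp only [t]
      ring
    rw [Finset.sum_congr rfl fun i _ => h i, ← Finset.sum_div, Finset.sum_add_distrib,
      ← Finset.mul_sum, ← Finset.mul_sum, hcol, hcol]
    simp
  obtain ⟨i₀⟩ : Nonempty (GaleIndex A β) := by
    by_contra hempty
    refine hproper (Set.Subset.antisymm (fun x hx => ((hg x).1 hx).1) fun x hx => ?_)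
    refine (hg x).2 ⟨hx, ?_⟩
    obtain ⟨w, -, -, rfl⟩ := (mem_convexHull_range_iff _ _).1 hx
    rw [map_sum]
    refine Finset.sum_eq_zero fun i _ => ?_
    have hi : castVec (point A i) ∈ β := by
      by_contra hi
      exact hempty ⟨⟨i, hi⟩⟩
    rw [map_smul, ((hg _).1 hi).2, smul_zero]
  have hnz : ∃ i ∈ (Finset.univ : Finset (GaleIndex A β)), g (castVec (point A i)) * t i ≠ 0 :=
    ⟨i₀, Finset.mem_univ _, mul_ne_zero (hgpos i₀).ne' (ht0 i₀)⟩
  obtain ⟨r, -, hr⟩ := Finset.exists_pos_of_sum_zero_of_exists_nonzero _ hsum hnz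
  obtain ⟨s, -, hs⟩ := Finset.exists_pos_of_sum_zero_of_exists_nonzero
    (fun i : GaleIndex A β => -(g (castVec (point A i)) * t i)) (by
      rw [Finset.sum_neg_distrib, hsum, neg_zero]) (by simpa using hnz)
  have htr : 0 < t r := pos_of_mul_pos_right hr (hgpos r).le
  have hts : t s < 0 := by
    by_contra! h
    have := mul_nonneg (hgpos s).le h
    linarith
  refine hrel ⟨Submodule.span ℝ {u}, ⟨finrank_span_singleton hu, r, s, ?_, ?_, hb r, -t s / t r,
    div_pos (by linarith) htr, ?_⟩, fun i => ?_⟩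
  · rw [ht]
    exact Submodule.smul_mem _ _ (Submodule.mem_span_singleton_self u)
  · rw [ht]
    exact Submodule.smul_mem _ _ (Submodule.mem_span_singleton_self u)
  · rw [ht, ht, smul_smul]
    congr 1
    field_simp
  · change castVec (B i) ∈ _
    rw [ht]
    exact Submodule.smul_mem _ _ (Submodule.mem_span_singleton_self u)

end Quotient

end ToricGale

end

/-! ### The volume and index formulas -/

open ToricGale in
theorem mainTheorem1 (d : ℕ) (A : Matrix (Fin d) (Fin (d + 2)) ℤ)
    (hA : IsToricMatrix A)
    (B : Matrix (Fin (d + 2)) (Fin 2) ℤ) (hB : IsGaleDual A B) (hb : ∀ i, B i ≠ 0)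
    (β : Set (Fin d → ℝ)) (hβ : IsFace A β) (hproper : β ≠ polytope A)
    (hrel : ¬ ∃ ℓ : Submodule ℝ (Fin 2 → ℝ), IsRelevantLine B ℓ ∧
      ∀ i : GaleIndex A β, castVec (galeRows A B β i) ∈ ℓ) :
    subdiagramVolume A (polytope A) β =
        (degree (latticeIdeal (galeRows' A B β)) : ℝ) / (torsionOrder (galeRows' A B β) : ℝ) -
          ((∑ j : GaleIndex A β with 0 < det2 (extraRow A B β) (galeRows A B β j),
            det2 (extraRow A B β) (galeRows A B β j) : ℤ) : ℝ) /
            (torsionOrder (galeRows' A B β) : ℝ) ∧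
      latticeIndex A (polytope A) β = torsionOrder (galeRows' A B β) ∧
      (torsionOrder (galeRows' A B β) : ℤ) = gcdMinors A B β := by
  classical
  obtain ⟨g, hg0, hg⟩ := hβ.exists_functional hA
  have hind := columnsIndependent_galeRows hB hb hproper hg0 hg hrel
  have hsat := isSaturationOf_ker_quotientMap hB hg0 hg
  have h₀ : galeRows' A B β none = -∑ i, galeRows A B β i := rfl
  have h₁ : ∀ i, galeRows' A B β (some i) = galeRows A B β i := fun _ => rfl
  -- A nonempty face contains a column of `A`, so `0` does belong to `A_P/β`.
  have hne : ∃ i, castVec (point A i) ∈ β := by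
    by_contra! h
    obtain ⟨x, hx⟩ := hβ.nonempty
    obtain ⟨w, hw1, hw0, -⟩ := exists_weights_of_mem hg0 hg hx
    rw [Finset.sum_eq_zero fun i _ => hw0 i (h i)] at hw1
    exact zero_ne_one hw1
  refine ⟨?_, ?_, torsionOrder_eq_gcd hind h₀ h₁ hsat⟩
  · have hdiff : quotientPoints A (polytope A) β \ {0} =
        Set.range fun i => quotientMap A β (Pi.single i 1) := by
      rw [quotientPoints_eq hne]
      ext q
      constructor
      · rintro ⟨rfl | hq, hq0⟩
        · exact absurd rfl hq0
        · exact hq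
      · rintro ⟨i, rfl⟩
        exact ⟨Or.inr ⟨i, rfl⟩, quotientMap_single_ne_zero hg i⟩
    rw [subdiagramVolume, hdiff, quotientPoints_eq hne,
      normalizedVolume_insert_zero hind h₀ h₁ quotientMap_surjective hsat,
      normalizedVolume_range hind h₀ h₁ quotientMap_surjective hsat]
    rfl
  · rw [latticeIndex_eq_relIndex hB, torsionOrder_eq_relIndex_ker h₀ h₁ hsat]
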